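/- Let $N\ge 2$, $\hbar>0$ and $k,\mu\in\mathbb R$. On smooth functions on $\mathbb R^N\setminus\{0\}$ let $x_j$ be multiplication by the $j$-th coordinate, $p_j=-i\hbar\,\partial_j$, $r=|x|$. For a set $s$ of indices let $$J_-^s=\sum_{j\in s}x_j^2,\qquad J_+^s=\sum_{j\in s}p_j^2,\qquad J_3^s=\sum_{j\in s}\bigl(x_jp_j-\tfrac{i\hbar}{2}\bigr),\qquad C^s=\tfrac12\bigl(J_+^sJ_-^s+J_-^sJ_+^s\bigr)-(J_3^s)^2$$ be the iterated coproducts of the one-dimensional realization $J_-=x^2,\ J_+=p^2,\ J_3=xp-\tfrac{i\hbar}2$ of $\mathfrak{sl}(2)$ and the corresponding Casimir element. Write $J_-,J_+,J_3,C$ when $s=\{1,\dots,N\}$, so that $J_-=r^2$ and $J_-^{-1/2}$ is multiplication by $1/r$; write $C^{(m)}$ when $s$ consists of the first $m$ indices and $C_{(m)}$ when $s$ consists of the last $m$ indices. The Hamiltonian is $$H=\tfrac12(1+k^2J_-)^2J_+-\frac{\mu}{\sqrt{J_-}}(1-k^2J_-).$$ Let $V\neq0$ be a complex normed space with continuous linear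 operators $\gamma_1,\dots,\gamma_N$ such that $\gamma_i\gamma_j+\gamma_j\gamma_i=2\delta_{ij}$, let all operators act on smooth $V$-valued functions on $\mathbb R^N\setminus\{0\}$ (the $x_j,p_j$ componentwise, the $\gamma_j$ on the values), and put $$L=\frac{\hbar(N-2)}2-\frac i2\sum_{j,l=1}^N\gamma_j\gamma_l\,(x_jp_l-x_lp_j).$$ Define $$A=\tfrac1{\sqrt2}\Bigl(-(L+\tfrac\hbar2)\tfrac{1+k^2J_-}{\sqrt{J_-}}(J_3+i\hbar)-i\,\tfrac{L(L+\frac\hbar2)}{\sqrt{J_-}}(1-k^2J_-)\Bigr)+\tfrac{i\mu}{\sqrt2},$$ $$A^\dagger=\tfrac1{\sqrt2}\Bigl(-(L+\tfrac\hbar2)\tfrac{1+k^2J_-}{\sqrt{J_-}}(J_3+i\hbar)+i\,\tfrac{L+\hbar}{\sqrt{J_-}}(L+\tfrac\hbar2)(1-k^2J_-)\Bigr)-\tfrac{i\mu}{\sqrt2},$$ $$L_1^+=L\tfrac{x_1}{\sqrt{J_-}}+\tfrac{i}{\sqrt{J_-}}(x_1J_3-J_-p_1),\qquad L_1^-=\tfrac{x_1}{\sqrt{J_-}}L-\tfrac{i}{\sqrt{J_-}}(x_1J_3-J_-p_1+i\hbar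 x_1),$$ $$R_+=\tfrac1{\sqrt2}(L_1^+A+A^\dagger L_1^-),\qquad R_-=\tfrac1{\sqrt2\,i}(L_1^+A-A^\dagger L_1^-).$$ Call a finite family of operators algebraically independent if no nonzero complex polynomial, evaluated on the family with every monomial completely symmetrized over all orderings of its factors, vanishes. Then $H=\tfrac12(1+k^2J_-)^2\bigl(\tfrac1{J_-}(J_3+i\hbar)^2+\tfrac{L^2}{J_-}\bigr)-\tfrac{\mu}{\sqrt{J_-}}(1-k^2J_-)$, and $H$ is maximally superintegrable: the $N$ operators $H,C^{(2)},\dots,C^{(N)}$ commute pairwise and are algebraically independent, and the $2N-1$ operators $$C^{(2)},\dots,C^{(N)},\quad C_{(2)},\dots,C_{(N-1)},\quad R_+,\ R_-$$ all commute with $H$ and are algebraically independent. If $N=2$, the same holds for scalar functions ($V=\mathbb C$), without any $\gamma_j$, with $L=x_1p_2-x_2p_1$. -/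

import Mathlib

open scoped ContDiff

noncomputable section

namespace Bertrand

/-! ### Algebraic independence and superintegrability in a noncommutative algebra -/

section Algebra

variable {ι A : Type*} [Ring A] [Algebra ℂ A]

/-- The completely symmetrized monomial: the average of the products of the factors `S i`, where `i`
occurs `m i` times, over all orderings of the factors. -/
def symMonomial (S : ι → A) (m : ι →₀ ℕ) : A :=
  (((Finsupp.toMultiset m).card.factorial : ℂ)⁻¹) •
    ((Finsupp.toMultiset m).lists.map fun l => (l.map S).prod).sum

/-- The completely symmetrized value of a polynomial at a family of operators. -/
def symEval (S : ι → A) (P : MvPolynomial ι ℂ) : A :=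
  ∑ m ∈ P.support, P.coeff m • symMonomial S m

/-- Operators are algebraically independent if no nonzero polynomial, symmetrized in the operators,
vanishes on them. -/
def AlgIndep (S : ι → A) : Prop :=
  ∀ P : MvPolynomial ι ℂ, symEval S P = 0 → P = 0

/-- `H` together with the `N - 1` operators `T i` forms an algebraically independent set of `N`
pairwise commuting operators. -/
structure IsIntegrable (N : ℕ) [Fintype ι] (H : A) (T : ι → A) : Prop where
  card_eq : Fintype.card ι + 1 = N
  commute_H : ∀ i, Commute H (T i)
  commute : ∀ i j, Commute (T i) (T j)
  algIndep : AlgIndep fun o : Option ι => o.elim H T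

/-- The family `S` consists of `2 N - 1` algebraically independent integrals of the motion of `H`. -/
structure HasMaximalIntegrals (N : ℕ) [Fintype ι] (H : A) (S : ι → A) : Prop where
  card_eq : Fintype.card ι + 1 = 2 * N
  commute_H : ∀ i, Commute H (S i)
  algIndep : AlgIndep S

end Algebra

/-! ### Operators on smooth vector-valued functions on the punctured space -/

/-- The configuration space `ℝ^N`, with its Euclidean norm `r = ‖x‖`. -/
abbrev Space (N : ℕ) : Type := EuclideanSpace ℝ (Fin N)

variable (N : ℕ) (V : Type*) [NormedAddCommGroup V] [NormedSpace ℂ V]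

/-- Smooth `V`-valued functions on `ℝ^N` minus the origin. Such a function is represented by its
extension by the value `0` at the origin, so that equality is equality on the punctured space. -/
def Wave : Submodule ℂ (Space N → V) where
  carrier := {ψ | ContDiffOn ℝ ∞ ψ {0}ᶜ ∧ ψ 0 = 0}
  add_mem' := fun ha hb => ⟨ha.1.add hb.1, by simp [ha.2, hb.2]⟩
  zero_mem' := ⟨contDiffOn_const, rfl⟩
  smul_mem' := fun c ψ h => ⟨h.1.const_smul c, by simp [h.2]⟩

/-- Linear operators on these functions. -/
abbrev Op : Type _ := Module.End ℂ (Wave N V)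

variable {N V}

/-- Multiplication by a real function that is smooth away from the origin. -/
def mulOp (f : Space N → ℝ) (hf : ContDiffOn ℝ ∞ f {0}ᶜ) : Op N V where
  toFun ψ := ⟨fun x => f x • ψ.1 x, hf.smul ψ.2.1, by simp [ψ.2.2]⟩
  map_add' ψ χ := by ext x; simp
  map_smul' c ψ := by
    ext x
    exact smul_comm (f x) c (ψ.1 x)

open Classical in
/-- The partial derivative `∂_j`. -/
def partialOp (j : Fin N) : Op N V where
  toFun ψ := ⟨fun x => if x = 0 then 0 else fderiv ℝ ψ.1 x (EuclideanSpace.single j 1), by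
    constructor
    · have h : ContDiffOn ℝ ∞ (fun x => fderiv ℝ ψ.1 x (EuclideanSpace.single j 1)) {0}ᶜ :=
        (ψ.2.1.fderiv_of_isOpen isOpen_compl_singleton (by simp)).clm_apply contDiffOn_const
      exact h.congr fun x hx => if_neg hx
    · simp⟩
  map_add' ψ χ := by
    ext x
    by_cases hx : x = 0
    · simp [hx]
    · have d : ∀ φ : Wave N V, DifferentiableAt ℝ φ.1 x := fun φ =>
        (φ.2.1.contDiffAt (isOpen_compl_singleton.mem_nhds hx)).differentiableAt (by simp)
      simp [hx, fderiv_add (d ψ) (d χ)]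
  map_smul' c ψ := by
    ext x
    by_cases hx : x = 0
    · simp [hx]
    · have d : DifferentiableAt ℝ ψ.1 x :=
        (ψ.2.1.contDiffAt (isOpen_compl_singleton.mem_nhds hx)).differentiableAt (by simp)
      simp [hx, fderiv_const_smul d c]

/-- A constant endomorphism of `V`, acting on the values of the functions. -/
def constOp (T : V →L[ℂ] V) : Op N V where
  toFun ψ := ⟨fun x => T (ψ.1 x),
    ((T.restrictScalars ℝ).contDiff.comp_contDiffOn ψ.2.1), by simp [ψ.2.2]⟩
  map_add' ψ χ := by ext x; simp
  map_smul' c ψ := by ext x; simp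

/-- The position operator `x_j`. -/
def X (j : Fin N) : Op N V :=
  mulOp (fun x => x j) (by fun_prop)

/-- The operator `1 / r`, which is `J_-^(-1/2)`. -/
def rInv : Op N V :=
  mulOp (fun x => ‖x‖⁻¹) ((contDiffOn_id.norm ℝ fun _ hx => hx).inv fun _ hx => norm_ne_zero_iff.2 hx)

/-- The momentum operator `p_j = -i ħ ∂_j`. -/
def P (ħ : ℝ) (j : Fin N) : Op N V := (-Complex.I * ħ) • partialOp j

/-! ### The coproducts of the realization of `sl(2)`

The one-particle realization is `J_- = x²`, `J_+ = p²`, `J_3 = x p - i ħ / 2`. As `J_-, J_+, J_3` are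
primitive, an iterated coproduct, placed on the tensor factors (that is, on the variables) indexed by
`s`, is the sum of the one-particle realizations over `s`. -/

def Jminus (s : Finset (Fin N)) : Op N V := ∑ j ∈ s, X j ^ 2

def Jplus (ħ : ℝ) (s : Finset (Fin N)) : Op N V := ∑ j ∈ s, P ħ j ^ 2

def J3 (ħ : ℝ) (s : Finset (Fin N)) : Op N V :=
  ∑ j ∈ s, (X j * P ħ j - (Complex.I * ħ / 2) • 1)

/-- The Casimir element `(J_+ J_- + J_- J_+) / 2 - J_3²` in the variables indexed by `s`. -/
def casimir (ħ : ℝ) (s : Finset (Fin N)) : Op N V :=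
  (1 / 2 : ℂ) • (Jplus ħ s * Jminus s + Jminus s * Jplus ħ s) - J3 ħ s ^ 2

/-- `C^(m)`: the Casimir element in the first `m` variables. -/
def casimirUp (ħ : ℝ) (m : ℕ) : Op N V := casimir ħ {i | i.val < m}

/-- `C_(m)`: the Casimir element in the last `m` variables. -/
def casimirDown (ħ : ℝ) (m : ℕ) : Op N V := casimir ħ {i | N ≤ i.val + m}

/-- The Hamiltonian `(1 + k² J_-)² J_+ / 2 - μ J_-^(-1/2) (1 - k² J_-)`. -/
def hamiltonian (ħ k μ : ℝ) : Op N V :=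
  (1 / 2 : ℂ) • ((1 + (k ^ 2 : ℂ) • Jminus .univ) ^ 2 * Jplus ħ .univ)
    - (μ : ℂ) • (rInv * (1 - (k ^ 2 : ℂ) • Jminus .univ))

/-! ### Angular momentum -/

/-- `L_{ij} = x_i p_j - x_j p_i`. -/
def angMom (ħ : ℝ) (i j : Fin N) : Op N V := X i * P ħ j - X j * P ħ i

/-- The relations `γ_i γ_j + γ_j γ_i = 2 δ_{ij}`. -/
def IsClifford (γ : Fin N → V →L[ℂ] V) : Prop :=
  ∀ i j, γ i * γ j + γ j * γ i = if i = j then 2 else 0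

/-- The total angular momentum `L = ħ (N - 2) / 2 - (i / 2) ∑_{j,l} γ_j γ_l L_{jl}`. -/
def totalAngMom (ħ : ℝ) (γ : Fin N → V →L[ℂ] V) : Op N V :=
  ((ħ * (N - 2) / 2 : ℂ)) • 1
    - (Complex.I / 2) • ∑ j, ∑ l, constOp (γ j) * constOp (γ l) * angMom ħ j l

/-! ### Ladder operators and generalized Runge-Lenz operators, for a given square root `L` of
`C + ħ²` -/

/-- `J_3 + i ħ`. -/
def J3shift (ħ : ℝ) : Op N V := J3 ħ .univ + (Complex.I * ħ) • 1

/-- The operator `A`. -/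
def ladderA (ħ k μ : ℝ) (L : Op N V) : Op N V :=
  ((Real.sqrt 2 : ℂ)⁻¹) •
    (-((L + (ħ / 2 : ℂ) • 1) * (1 + (k ^ 2 : ℂ) • Jminus .univ) * rInv * J3shift ħ)
      - Complex.I • (L * (L + (ħ / 2 : ℂ) • 1) * rInv * (1 - (k ^ 2 : ℂ) • Jminus .univ)))
  + (Complex.I * μ / Real.sqrt 2) • 1

/-- The operator `A†`. -/
def ladderAdag (ħ k μ : ℝ) (L : Op N V) : Op N V :=
  ((Real.sqrt 2 : ℂ)⁻¹) •
    (-((L + (ħ / 2 : ℂ) • 1) * (1 + (k ^ 2 : ℂ) • Jminus .univ) * rInv * J3shift ħ)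
      + Complex.I • ((L + (ħ : ℂ) • 1) * rInv * (L + (ħ / 2 : ℂ) • 1)
          * (1 - (k ^ 2 : ℂ) • Jminus .univ)))
  - (Complex.I * μ / Real.sqrt 2) • 1

/-- The operator `L_j^+ = L x_j / r + (i / r) (x_j J_3 - J_- p_j)`. -/
def Lplus (ħ : ℝ) (L : Op N V) (j : Fin N) : Op N V :=
  L * (X j * rInv)
    + Complex.I • (rInv * (X j * J3 ħ .univ - Jminus .univ * P ħ j))

/-- The operator `L_j^- = (x_j / r) L - (i / r) (x_j J_3 - J_- p_j + i ħ x_j)`. -/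
def Lminus (ħ : ℝ) (L : Op N V) (j : Fin N) : Op N V :=
  X j * rInv * L
    - Complex.I • (rInv * (X j * J3 ħ .univ - Jminus .univ * P ħ j + (Complex.I * ħ) • X j))

/-- `R_+ = (L_j^+ A + A† L_j^-) / √2`. -/
def Rplus (ħ k μ : ℝ) (L : Op N V) (j : Fin N) : Op N V :=
  ((Real.sqrt 2 : ℂ)⁻¹) •
    (Lplus ħ L j * ladderA ħ k μ L + ladderAdag ħ k μ L * Lminus ħ L j)

/-- `R_- = (L_j^+ A - A† L_j^-) / (√2 i)`. -/
def Rminus (ħ k μ : ℝ) (L : Op N V) (j : Fin N) : Op N V :=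
  ((Real.sqrt 2 * Complex.I : ℂ)⁻¹) •
    (Lplus ħ L j * ladderA ħ k μ L - ladderAdag ħ k μ L * Lminus ħ L j)

/-- The family made of `C^(2), …, C^(N)`, of `C_(2), …, C_(N-1)`, and of `R_+, R_-`. -/
def integrals (ħ k μ : ℝ) (L : Op N V) (j : Fin N) :
    Fin (N - 1) ⊕ Fin (N - 2) ⊕ Bool → Op N V
  | .inl m => casimirUp ħ (m + 2)
  | .inr (.inl m) => casimirDown ħ (m + 2)
  | .inr (.inr true) => Rplus ħ k μ L j
  | .inr (.inr false) => Rminus ħ k μ L j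

/-- The expression of the Hamiltonian through `L`:
`(1 + k² J_-)² (J_-⁻¹ (J_3 + i ħ)² + J_-⁻¹ L²) / 2 - μ J_-^(-1/2) (1 - k² J_-)`. -/
def hamiltonianOf (ħ k μ : ℝ) (L : Op N V) : Op N V :=
  (1 / 2 : ℂ) • ((1 + (k ^ 2 : ℂ) • Jminus .univ) ^ 2 *
      (rInv ^ 2 * J3shift ħ ^ 2 + rInv ^ 2 * L ^ 2))
    - (μ : ℂ) • (rInv * (1 - (k ^ 2 : ℂ) • Jminus .univ))

end Bertrand

end

open scoped ContDiff

noncomputable section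

namespace Bertrand

/-! ### Ladder, shift and square identities in an abstract algebra -/

section Algebra

variable {A : Type*} [Ring A] [Algebra ℂ A]

/-! Commutation. Put `ε = iħ`, `M = iL`, `D = J_3 + iħ`, `F = (1 + k²r²)/r`, `G = (1 - k²r²)/r`.
Since `L² = C + ħ²`, the Hamiltonian is purely radial: `H(M) = ½F²(D² - M²) - μG`. Here `M` commutes
with `F, G, D`, and these satisfy the closed relations `[D, F] = εG`, `[D, G] = εF`, `G² = F² -
4k²`. They suffice for `𝒜(M) = (M + ε/2)FD + M(M + ε/2)G + μ` to intertwine neighbouring radial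
Hamiltonians: `H(M + ε)𝒜(M) = 𝒜(M)H(M)` (`intertwine`). Up to scalars, `A` is `𝒜(M)` and `A†` is
`𝒜(-M - ε)`. The operators `L_1^±` commute with `F, G, D` and shift `M` by `±ε`, so each of `L_1^+
A` and `A† L_1^-` undoes the shift and commutes with `H`, the second one because `H` is even in `M`
(`radialHam_commute`). The square and shift relations of `M` come from the Clifford elements `∑ γ_j
x_j` and `∑ γ_j p_j` (`SlashRel.shift_up`, `sq_eq_casimir`), or by hand in the plane
(`WeylRel.rootRel_plane`). The Casimir elements commute with `H` because they are quadratic in the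
angular momenta `L_ij` (`WeylRel.cas_eq`).

Independence. Conjugation by `exp(τ⟨ξ, x⟩)` turns an operator of order `d` into a polynomial in `τ`,
whose coefficient of `τ^d` is its principal symbol. Symbols multiply, so a symmetrized relation
forces a relation between symbols. Among the operators involved, only `L` brings in a matrix-valued
symbol; its square is scalar, a multiple of the Gram determinant of `x` and `ξ`, and it has an
eigenvector for a prescribed square root. On that vector all symbols act by numbers, which leaves a
nonzero commutative polynomial vanishing on these numbers (`exists_symbol_relation`).

That polynomial is evaluated along curves `x = uX`, `ξ = (y, u(cX_i + u^i Ξ_i))` with `X_0 = 0` and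
`u → 0+`. Each eigenvalue is a power of `u` times a continuous function, and the leading
coefficients are triangular in the parameters: partial sums of `X_i²` for `C^(m)`, `Ξ_a` for the
`C_(m)` starting at coordinate `a`, `y` for `R_+`, `c` for `R_-`. Hence they fill a product of
intervals, on which the nonzero initial form of the polynomial would have to vanish
(`exists_initial_form`, `algIndep_of_curves`). -/

set_option linter.unusedSimpArgs false in
-- The hypotheses act as rewriting rules that bring every word to a normal form with `M` and `D`
-- moved past `F, G` and `G²` eliminated; both sides then agree as linear combinations. The value of
-- `q` plays no role beyond being a scalar.
theorem intertwine {F G D M : A} {ε q μ : ℂ} (hMF : M * F = F * M) (hMG : M * G = G * M)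
    (hMD : M * D = D * M) (hFG : G * F = F * G) (hDF : D * F = F * D + ε • G)
    (hDG : D * G = G * D + ε • F) (hGG : G * G = F * F - q • 1) :
    ((1 / 2 : ℂ) • (F * F * (D * D - (M + ε • 1) * (M + ε • 1))) - μ • G)
        * ((M + (ε / 2) • 1) * (F * D) + M * (M + (ε / 2) • 1) * G + μ • 1)
      = ((M + (ε / 2) • 1) * (F * D) + M * (M + (ε / 2) • 1) * G + μ • 1)
        * ((1 / 2 : ℂ) • (F * F * (D * D - M * M)) - μ • G) := by
  have hMF' : ∀ x, M * (F * x) = F * (M * x) := fun x => by rw [← mul_assoc, hMF, mul_assoc]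
  have hMG' : ∀ x, M * (G * x) = G * (M * x) := fun x => by rw [← mul_assoc, hMG, mul_assoc]
  have hMD' : ∀ x, D * (M * x) = M * (D * x) := fun x => by rw [← mul_assoc, ← hMD, mul_assoc]
  have hFG' : ∀ x, G * (F * x) = F * (G * x) := fun x => by rw [← mul_assoc, hFG, mul_assoc]
  have hDF' : ∀ x, D * (F * x) = F * (D * x) + ε • (G * x) := fun x => by
    rw [← mul_assoc, hDF, add_mul, mul_assoc, smul_mul_assoc]
  have hDG' : ∀ x, D * (G * x) = G * (D * x) + ε • (F * x) := fun x => by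
    rw [← mul_assoc, hDG, add_mul, mul_assoc, smul_mul_assoc]
  have hGG' : ∀ x, G * (G * x) = F * (F * x) - q • x := fun x => by
    rw [← mul_assoc, hGG, sub_mul, mul_assoc, smul_mul_assoc, one_mul]
  simp only [mul_add, add_mul, mul_sub, sub_mul, smul_mul_assoc, mul_smul_comm, mul_assoc, smul_add,
    smul_sub, one_mul, mul_one, hMF, hMG, ← hMD, hFG, hDF, hDG, hGG, hMF', hMG', hMD', hFG', hDF',
    hDG', hGG']
  module

/-- The relations between `a = ∑ γ_j x_j`, `b = ∑ γ_j p_j`, `c = γ_j`, `X = x_j`, `P = p_j`,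
with `ε = i ħ`. -/
structure SlashRel (ε : ℂ) (a b c X P : A) : Prop where
  baa : b * (a * a) = a * (a * b) - (2 * ε) • a
  bba : b * (b * a) = a * (b * b) - (2 * ε) • b
  aX : a * X = X * a
  bX : b * X = X * b - ε • c
  aP : a * P = P * a + ε • c
  bP : b * P = P * b
  PX : P * X = X * P - ε • 1
  cX : c * X = X * c
  cP : c * P = P * c
  ac : a * c = (2 : ℂ) • X - c * a
  bc : b * c = (2 : ℂ) • P - c * b
  cc : c * c = 1

-- With `a = ∑ γ_j x_j` and `b = ∑ γ_j p_j`, the angular momentum is the antisymmetric and `J_3` the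
-- symmetric part of `ab`. The two combinations are, up to the factor `1/r` and a scalar, `L_j^+`
-- and `L_j^-`: they raise and lower `M` by `ε`. The proof is again reduction to normal form.
set_option linter.unusedSimpArgs false in
theorem SlashRel.shift_up {ε : ℂ} {a b c X P : A} (h : SlashRel ε a b c X P) {M J : A}
    (hM : M = (1 / 2 : ℂ) • (a * b - b * a) - ε • 1) (hJ : J = (1 / 2 : ℂ) • (a * b + b * a)) :
    M * (M * X - X * J + a * a * P) = (M * X - X * J + a * a * P) * (M + ε • 1) ∧
    M * (X * M + X * J - a * a * P + ε • X) = (X * M + X * J - a * a * P + ε • X) * (M - ε • 1) := by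
  obtain ⟨baa, bba, aX, bX, aP, bP, PX, cX, cP, ac, bc, cc⟩ := h
  have baa' : ∀ x, b * (a * (a * x)) = a * (a * (b * x)) - (2 * ε) • (a * x) := fun x => by
    simpa only [sub_mul, mul_assoc, smul_mul_assoc] using congrArg (· * x) baa
  have bba' : ∀ x, b * (b * (a * x)) = a * (b * (b * x)) - (2 * ε) • (b * x) := fun x => by
    simpa only [sub_mul, mul_assoc, smul_mul_assoc] using congrArg (· * x) bba
  have aX' : ∀ x, a * (X * x) = X * (a * x) := fun x => by
    simpa only [mul_assoc] using congrArg (· * x) aX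
  have cX' : ∀ x, c * (X * x) = X * (c * x) := fun x => by
    simpa only [mul_assoc] using congrArg (· * x) cX
  have cP' : ∀ x, c * (P * x) = P * (c * x) := fun x => by
    simpa only [mul_assoc] using congrArg (· * x) cP
  have bP' : ∀ x, b * (P * x) = P * (b * x) := fun x => by
    simpa only [mul_assoc] using congrArg (· * x) bP
  have bX' : ∀ x, b * (X * x) = X * (b * x) - ε • (c * x) := fun x => by
    simpa only [sub_mul, mul_assoc, smul_mul_assoc] using congrArg (· * x) bX
  have aP' : ∀ x, a * (P * x) = P * (a * x) + ε • (c * x) := fun x => by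
    simpa only [add_mul, mul_assoc, smul_mul_assoc] using congrArg (· * x) aP
  have PX' : ∀ x, P * (X * x) = X * (P * x) - ε • x := fun x => by
    simpa only [sub_mul, mul_assoc, smul_mul_assoc, one_mul] using congrArg (· * x) PX
  have ac' : ∀ x, a * (c * x) = (2 : ℂ) • (X * x) - c * (a * x) := fun x => by
    simpa only [sub_mul, mul_assoc, smul_mul_assoc] using congrArg (· * x) ac
  have bc' : ∀ x, b * (c * x) = (2 : ℂ) • (P * x) - c * (b * x) := fun x => by
    simpa only [sub_mul, mul_assoc, smul_mul_assoc] using congrArg (· * x) bc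
  have cc' : ∀ x, c * (c * x) = x := fun x => by rw [← mul_assoc, cc, one_mul]
  subst hM hJ
  constructor
  all_goals
    simp only [mul_add, add_mul, mul_sub, sub_mul, smul_mul_assoc, mul_smul_comm, mul_assoc,
      smul_add, smul_sub, one_mul, mul_one, baa, bba, aX, bX, aP, bP, PX, cX, cP, ac, bc, cc, baa',
      bba', aX', bX', aP', bP', PX', cX', cP', ac', bc', cc']
    module

-- As `a² = J_-` and `b² = J_+`, this is `L² = C + ħ²` for `M = iL`, `ε = iħ`.
set_option linter.unusedSimpArgs false in
theorem sq_eq_casimir {ε : ℂ} {a b : A} (baa : b * (a * a) = a * (a * b) - (2 * ε) • a)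
    (bba : b * (b * a) = a * (b * b) - (2 * ε) • b) {M J : A}
    (hM : M = (1 / 2 : ℂ) • (a * b - b * a) - ε • 1) (hJ : J = (1 / 2 : ℂ) • (a * b + b * a)) :
    -(M * M) = (1 / 2 : ℂ) • (b * b * (a * a) + a * a * (b * b)) - J * J - (ε * ε) • 1 := by
  have baa' : ∀ x, b * (a * (a * x)) = a * (a * (b * x)) - (2 * ε) • (a * x) := fun x => by
    simpa only [sub_mul, mul_assoc, smul_mul_assoc] using congrArg (· * x) baa
  have bba' : ∀ x, b * (b * (a * x)) = a * (b * (b * x)) - (2 * ε) • (b * x) := fun x => by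
    simpa only [sub_mul, mul_assoc, smul_mul_assoc] using congrArg (· * x) bba
  subst hM hJ
  simp only [mul_add, add_mul, mul_sub, sub_mul, smul_mul_assoc, mul_smul_comm, mul_assoc,
      smul_add, smul_sub, one_mul, mul_one, baa, bba, baa', bba']
  module

end Algebra

/-! ### Commutation relations of positions and momenta -/

section PositionMomentum

variable {N : ℕ} {V : Type*} [NormedAddCommGroup V] [NormedSpace ℂ V]

theorem wave_contDiffAt (ψ : Wave N V) {x : Space N} (hx : x ≠ 0) : ContDiffAt ℝ ∞ ψ.1 x :=
  ψ.2.1.contDiffAt (isOpen_compl_singleton.mem_nhds hx)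

/-- Every wave takes the conventional value `0` at the origin, so only the punctured space has to be
compared. -/
theorem Op.ext_apply {S T : Op N V} (h : ∀ ψ x, x ≠ 0 → (S ψ).1 x = (T ψ).1 x) : S = T := by
  refine LinearMap.ext fun ψ => Subtype.ext <| funext fun x => ?_
  by_cases hx : x = 0
  · rw [hx, (S ψ).2.2, (T ψ).2.2]
  · exact h ψ x hx

@[simp]
theorem mulOp_apply (f : Space N → ℝ) (hf : ContDiffOn ℝ ∞ f {0}ᶜ) (ψ : Wave N V) (x : Space N) :
    (mulOp f hf ψ).1 x = f x • ψ.1 x := rfl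

@[simp]
theorem constOp_apply (T : V →L[ℂ] V) (ψ : Wave N V) (x : Space N) :
    (constOp T ψ).1 x = T (ψ.1 x) := rfl

@[simp]
theorem X_apply (j : Fin N) (ψ : Wave N V) (x : Space N) : (X j ψ).1 x = x j • ψ.1 x := rfl

@[simp]
theorem rInv_apply (ψ : Wave N V) (x : Space N) : (rInv ψ).1 x = ‖x‖⁻¹ • ψ.1 x := rfl

theorem partialOp_apply (j : Fin N) (ψ : Wave N V) {x : Space N} (hx : x ≠ 0) :
    (partialOp j ψ).1 x = fderiv ℝ ψ.1 x (EuclideanSpace.single j 1) := if_neg hx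

theorem mulOp_commute (f g : Space N → ℝ) (hf : ContDiffOn ℝ ∞ f {0}ᶜ)
    (hg : ContDiffOn ℝ ∞ g {0}ᶜ) : Commute (mulOp f hf : Op N V) (mulOp g hg) :=
  Op.ext_apply fun ψ x _ => by simp [smul_comm (f x)]

theorem constOp_commute_mulOp (T : V →L[ℂ] V) (f : Space N → ℝ) (hf : ContDiffOn ℝ ∞ f {0}ᶜ) :
    Commute (constOp T : Op N V) (mulOp f hf) :=
  Op.ext_apply fun ψ x _ => by simp

theorem constOp_mul (S T : V →L[ℂ] V) : (constOp (S * T) : Op N V) = constOp S * constOp T := rfl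

theorem constOp_add (S T : V →L[ℂ] V) : (constOp (S + T) : Op N V) = constOp S + constOp T := rfl

theorem constOp_commute_partialOp (T : V →L[ℂ] V) (j : Fin N) :
    Commute (constOp T : Op N V) (partialOp j) := by
  refine Op.ext_apply fun ψ x hx => ?_
  have hd := (wave_contDiffAt ψ hx).differentiableAt (by simp)
  simp only [Module.End.mul_apply, constOp_apply, partialOp_apply _ _ hx]
  have : (constOp T ψ).1 = (T.restrictScalars ℝ) ∘ ψ.1 := rfl
  rw [this, ((T.restrictScalars ℝ).hasFDerivAt.comp x hd.hasFDerivAt).fderiv]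
  rfl

theorem partialOp_mul_mulOp (j : Fin N) {f g : Space N → ℝ} (hf : ContDiffOn ℝ ∞ f {0}ᶜ)
    (hg : ContDiffOn ℝ ∞ g {0}ᶜ)
    (h : ∀ x, x ≠ 0 → fderiv ℝ f x (EuclideanSpace.single j 1) = g x) :
    (partialOp j * mulOp f hf : Op N V) = mulOp f hf * partialOp j + mulOp g hg := by
  refine Op.ext_apply fun ψ x hx => ?_
  have hd := (wave_contDiffAt ψ hx).differentiableAt (by simp)
  have hfd := (hf.contDiffAt (isOpen_compl_singleton.mem_nhds hx)).differentiableAt (by simp)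
  have : (mulOp f hf ψ).1 = fun y => f y • ψ.1 y := rfl
  simp only [Module.End.mul_apply, partialOp_apply _ _ hx, LinearMap.add_apply, Submodule.coe_add,
    Pi.add_apply, mulOp_apply, this]
  rw [fderiv_fun_smul hfd hd]
  simp [h x hx]

theorem partialOp_commute (i j : Fin N) : Commute (partialOp i : Op N V) (partialOp j) := by
  refine Op.ext_apply fun ψ x hx => ?_
  have hc : ContDiffAt ℝ 2 ψ.1 x := (wave_contDiffAt ψ hx).of_le (by norm_cast)
  have key : ∀ k l : Fin N, ((partialOp k * partialOp l : Op N V) ψ).1 x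
      = fderiv ℝ (fderiv ℝ ψ.1) x (EuclideanSpace.single k 1) (EuclideanSpace.single l 1) := by
    intro k l
    have he : (partialOp l ψ).1 =ᶠ[nhds x] fun y => fderiv ℝ ψ.1 y (EuclideanSpace.single l 1) :=
      (isOpen_compl_singleton.eventually_mem hx).mono fun y hy => partialOp_apply l ψ hy
    have hd : DifferentiableAt ℝ (fderiv ℝ ψ.1) x :=
      (hc.fderiv_right (m := 1) (by norm_num)).differentiableAt (by simp)
    rw [Module.End.mul_apply, partialOp_apply _ _ hx, he.fderiv_eq,
      fderiv_clm_apply hd (differentiableAt_const _)]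
    simp
  rw [key, key]
  exact (hc.isSymmSndFDerivAt (by simp)) _ _

variable (ħ : ℝ)

theorem X_commute (i j : Fin N) : Commute (X i : Op N V) (X j) := mulOp_commute ..

theorem X_commute_rInv (i : Fin N) : Commute (X i : Op N V) rInv := mulOp_commute ..

theorem constOp_commute_X (T : V →L[ℂ] V) (i : Fin N) : Commute (constOp T : Op N V) (X i) :=
  constOp_commute_mulOp ..

theorem constOp_commute_rInv (T : V →L[ℂ] V) : Commute (constOp T : Op N V) rInv :=
  constOp_commute_mulOp ..

theorem constOp_commute_P (T : V →L[ℂ] V) (i : Fin N) : Commute (constOp T : Op N V) (P ħ i) :=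
  (constOp_commute_partialOp T i).smul_right _

theorem P_commute (i j : Fin N) : Commute (P ħ i : Op N V) (P ħ j) :=
  ((partialOp_commute i j).smul_right _).smul_left _

theorem P_mul_X (i j : Fin N) : (P ħ i * X j : Op N V)
    = X j * P ħ i - (if i = j then Complex.I * ħ else 0 : ℂ) • 1 := by
  have h := partialOp_mul_mulOp (V := V) i (f := fun x => x j) (g := fun _ => if i = j then 1 else 0)
    (by fun_prop) contDiffOn_const (fun x _ => by
      have : (fun x : Space N => x j) = EuclideanSpace.proj (𝕜 := ℝ) j := rfl
      rw [this, ContinuousLinearMap.fderiv]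
      simp [eq_comm])
  have h1 : (mulOp (fun _ => if i = j then 1 else 0) contDiffOn_const : Op N V)
      = (if i = j then 1 else 0 : ℂ) • 1 := Op.ext_apply fun ψ x _ => by split_ifs <;> simp_all
  rw [P, X, smul_mul_assoc, h, h1, mul_smul_comm]
  split_ifs <;> module

theorem rInv_mul_rInv_mul_Jminus : (rInv * rInv * Jminus .univ : Op N V) = 1 := by
  refine Op.ext_apply fun ψ x hx => ?_
  have hx' : ‖x‖ ≠ 0 := norm_ne_zero_iff.2 hx
  have h : ((Jminus .univ : Op N V) ψ).1 x = (‖x‖ ^ 2) • ψ.1 x := by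
    rw [EuclideanSpace.real_norm_sq_eq, Jminus, LinearMap.sum_apply]
    simp only [Submodule.coe_sum, Finset.sum_apply, Finset.sum_smul]
    refine Finset.sum_congr rfl fun i _ => ?_
    simp [sq, mul_smul]
  simp only [Module.End.mul_apply, rInv_apply, h, Module.End.one_apply, smul_smul]
  rw [show ‖x‖⁻¹ * (‖x‖⁻¹ * ‖x‖ ^ 2) = 1 by field_simp, one_smul]

theorem P_mul_rInv (i : Fin N) : (P ħ i * rInv : Op N V)
    = rInv * P ħ i + (Complex.I * ħ) • (X i * (rInv * (rInv * rInv))) := by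
  have hs : ContDiffOn ℝ ∞ (fun x : Space N => ‖x‖⁻¹) {0}ᶜ :=
    (contDiffOn_id.norm ℝ fun _ hx => hx).inv fun _ hx => norm_ne_zero_iff.2 hx
  have hg : ContDiffOn ℝ ∞ (fun x : Space N => -(x i * (‖x‖⁻¹ * (‖x‖⁻¹ * ‖x‖⁻¹)))) {0}ᶜ :=
    (ContDiffOn.mul (by fun_prop) (hs.mul (hs.mul hs))).neg
  have h := partialOp_mul_mulOp (V := V) i hs hg (fun x hx => by
      have h1 : HasFDerivAt (fun x : Space N => ‖x‖ ^ 2) _ x := (hasStrictFDerivAt_norm_sq x).hasFDerivAt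
      have hx' : ‖x‖ ≠ 0 := norm_ne_zero_iff.2 hx
      -- The norm is differentiated as the square root of its square, which is smooth everywhere.
      have h2 : HasFDerivAt (fun x : Space N => (√(‖x‖ ^ 2))⁻¹) _ x :=
        (hasDerivAt_inv (by simpa using hx')).comp_hasFDerivAt x (h1.sqrt (by positivity))
      have h3 : (fun x : Space N => (√(‖x‖ ^ 2))⁻¹) = fun x => ‖x‖⁻¹ := by
        ext x; rw [Real.sqrt_sq (norm_nonneg _)]
      rw [h3] at h2
      rw [h2.fderiv]
      simp [EuclideanSpace.inner_single_right]
      field_simp)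
  have h1 : (mulOp _ hg : Op N V) = -(X i * (rInv * (rInv * rInv))) :=
    Op.ext_apply fun ψ x _ => by simp [smul_smul]
  rw [P, rInv, smul_mul_assoc, h, h1, mul_smul_comm]
  simp only [rInv]
  module

end PositionMomentum

/-! ### Positions and momenta in an abstract algebra -/

section Weyl

variable {A n : Type*} [Ring A] [Algebra ℂ A] [Fintype n] [DecidableEq n]

/-- The commutation relations of positions `X`, momenta `P` and the inverse `ρ` of the radius, with
`ε = i ħ`. -/
structure WeylRel (ε : ℂ) (X P : n → A) (ρ : A) : Prop where
  X_comm : ∀ i j, Commute (X i) (X j)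
  P_comm : ∀ i j, Commute (P i) (P j)
  X_rho : ∀ i, Commute (X i) ρ
  P_X : ∀ i j, P i * X j = X j * P i - (if i = j then ε else 0) • 1
  P_rho : ∀ i, P i * ρ = ρ * P i + ε • (X i * (ρ * (ρ * ρ)))
  rho_sq : ρ * ρ * ∑ j, X j ^ 2 = 1

/-- The sum of the squares over `s`. -/
def sumSq (X : n → A) (s : Finset n) : A := ∑ j ∈ s, X j ^ 2

/-- `J_3` in the variables indexed by `s`. -/
def dil (ε : ℂ) (X P : n → A) (s : Finset n) : A := ∑ j ∈ s, (X j * P j - (ε / 2) • 1)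

/-- The Casimir element in the variables indexed by `s`. -/
def cas (ε : ℂ) (X P : n → A) (s : Finset n) : A :=
  (1 / 2 : ℂ) • (sumSq P s * sumSq X s + sumSq X s * sumSq P s) - dil ε X P s ^ 2

/-- `x_i p_j - x_j p_i`. -/
def ang (X P : n → A) (i j : n) : A := X i * P j - X j * P i

variable {ε : ℂ} {X P : n → A} {ρ : A} {s t : Finset n}

theorem dil_eq {A n : Type*} [Ring A] [Algebra ℂ A] {ε : ℂ} {X P : n → A} {s : Finset n} :
    dil ε X P s = ∑ j ∈ s, X j * P j - (s.card * (ε / 2)) • (1 : A) := by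
  simp only [dil, Finset.sum_sub_distrib, Finset.sum_const]
  rw [← Nat.cast_smul_eq_nsmul ℂ, smul_smul]

namespace WeylRel

theorem X_commute_sumSq (h : WeylRel ε X P ρ) (i : n) : Commute (X i) (sumSq X s) :=
  Commute.sum_right _ _ _ fun j _ => (h.X_comm i j).pow_right 2

theorem P_commute_sumSq (h : WeylRel ε X P ρ) (i : n) : Commute (P i) (sumSq P s) :=
  Commute.sum_right _ _ _ fun j _ => (h.P_comm i j).pow_right 2

theorem rho_commute_sumSq (h : WeylRel ε X P ρ) : Commute ρ (sumSq X s) :=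
  Commute.sum_right _ _ _ fun j _ => (h.X_rho j).symm.pow_right 2

theorem P_mul_sumSq (h : WeylRel ε X P ρ) {i : n} (hi : i ∈ s) :
    P i * sumSq X s = sumSq X s * P i - (2 * ε) • X i := by
  have key : ∀ j, P i * X j ^ 2 = X j ^ 2 * P i - if i = j then (2 * ε) • X j else 0 := by
    intro j
    rw [sq, ← mul_assoc, h.P_X, sub_mul, mul_assoc, h.P_X, mul_sub, ← mul_assoc, mul_smul_comm,
      smul_mul_assoc, one_mul, mul_one]
    split_ifs <;> module
  simp only [sumSq, Finset.mul_sum, Finset.sum_mul, key, Finset.sum_sub_distrib,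
    Finset.sum_ite_eq, if_pos hi]

theorem sumSq_mul_X (h : WeylRel ε X P ρ) {i : n} (hi : i ∈ s) :
    sumSq P s * X i = X i * sumSq P s - (2 * ε) • P i := by
  have key : ∀ j, P j ^ 2 * X i = X i * P j ^ 2 - if i = j then (2 * ε) • P j else 0 := by
    intro j
    rw [sq, mul_assoc, h.P_X, mul_sub, ← mul_assoc, h.P_X, sub_mul, mul_assoc, mul_smul_comm,
      smul_mul_assoc, one_mul, mul_one]
    by_cases hij : i = j
    · subst hij; simp only [if_true]; module
    · simp only [hij, Ne.symm hij, if_false]; module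
  simp only [sumSq, Finset.mul_sum, Finset.sum_mul, key, Finset.sum_sub_distrib,
    Finset.sum_ite_eq, if_pos hi]

theorem dil_mul_X (h : WeylRel ε X P ρ) {i : n} (hi : i ∈ s) :
    dil ε X P s * X i = X i * dil ε X P s - ε • X i := by
  have key : ∀ j, X j * P j * X i = X i * (X j * P j) - if i = j then ε • X j else 0 := by
    intro j
    rw [mul_assoc, h.P_X, mul_sub, ← mul_assoc, (h.X_comm j i).eq, mul_assoc, mul_smul_comm,
      mul_one]
    by_cases hij : i = j
    · subst hij; simp only [if_true]
    · simp only [hij, Ne.symm hij, if_false]; module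
  simp only [dil_eq, sub_mul, mul_sub, Finset.mul_sum, Finset.sum_mul, key, Finset.sum_sub_distrib,
    Finset.sum_ite_eq, if_pos hi, smul_mul_assoc, mul_smul_comm, one_mul, mul_one]
  module

theorem dil_mul_P (h : WeylRel ε X P ρ) {i : n} (hi : i ∈ s) :
    dil ε X P s * P i = P i * dil ε X P s + ε • P i := by
  have key : ∀ j, P i * (X j * P j) = X j * P j * P i - if i = j then ε • P j else 0 := by
    intro j
    rw [← mul_assoc, h.P_X, sub_mul, mul_assoc, (h.P_comm i j).eq, mul_assoc, smul_mul_assoc,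
      one_mul]
    split_ifs <;> module
  simp only [dil_eq, sub_mul, mul_sub, Finset.mul_sum, Finset.sum_mul, key, Finset.sum_sub_distrib,
    Finset.sum_ite_eq, if_pos hi, smul_mul_assoc, mul_smul_comm, one_mul, mul_one]
  module

theorem dil_mul_rho (h : WeylRel ε X P ρ) :
    dil ε X P .univ * ρ = ρ * dil ε X P .univ + ε • ρ := by
  have key : ∀ j, X j * P j * ρ = ρ * (X j * P j) + ε • (ρ * (ρ * ρ) * X j ^ 2) := by
    intro j
    have h3 : Commute (X j) (ρ * (ρ * ρ)) :=
      (h.X_rho j).mul_right ((h.X_rho j).mul_right (h.X_rho j))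
    have h4 : X j * (X j * (ρ * (ρ * ρ))) = ρ * (ρ * ρ) * X j ^ 2 := by
      rw [← mul_assoc, ← sq, (h3.pow_left 2).eq]
    rw [mul_assoc, h.P_rho, mul_add, ← mul_assoc, (h.X_rho j).eq, mul_assoc, mul_smul_comm, h4]
  have h2 : ∑ j, ρ * (ρ * ρ) * X j ^ 2 = ρ := by
    rw [← Finset.mul_sum, mul_assoc ρ, h.rho_sq, mul_one]
  simp only [dil_eq, sub_mul, mul_sub, Finset.mul_sum, Finset.sum_mul, key, Finset.sum_add_distrib,
    ← Finset.smul_sum, h2, smul_mul_assoc, mul_smul_comm, one_mul, mul_one]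
  module

theorem dil_mul_sumSq (h : WeylRel ε X P ρ) :
    dil ε X P s * sumSq X s = sumSq X s * dil ε X P s - (2 * ε) • sumSq X s := by
  have key : ∀ j ∈ s, dil ε X P s * X j ^ 2 = X j ^ 2 * dil ε X P s - (2 * ε) • X j ^ 2 := by
    intro j hj
    rw [sq, ← mul_assoc, h.dil_mul_X hj, sub_mul, mul_assoc, h.dil_mul_X hj, mul_sub, ← mul_assoc,
      mul_smul_comm, smul_mul_assoc]
    module
  rw [sumSq, Finset.mul_sum, Finset.sum_congr rfl key, Finset.sum_sub_distrib, Finset.smul_sum,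
    Finset.sum_mul]

theorem sumSq_mul_sumSq (h : WeylRel ε X P ρ) :
    sumSq P s * sumSq X s = sumSq X s * sumSq P s - (4 * ε) • dil ε X P s := by
  have key : ∀ j ∈ s, sumSq P s * X j ^ 2
      = X j ^ 2 * sumSq P s - (4 * ε) • (X j * P j - (ε / 2) • 1) := by
    intro j hj
    rw [sq, ← mul_assoc, h.sumSq_mul_X hj, sub_mul, mul_assoc, h.sumSq_mul_X hj, mul_sub,
      ← mul_assoc, mul_smul_comm, smul_mul_assoc, h.P_X, if_pos rfl]
    module
  rw [sumSq, sumSq, Finset.mul_sum, ← sumSq, Finset.sum_congr rfl key, Finset.sum_sub_distrib, dil,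
    Finset.smul_sum, Finset.sum_mul]

theorem ang_commute_sumSq_X (h : WeylRel ε X P ρ) {i j : n} (hi : i ∈ s) (hj : j ∈ s) :
    Commute (ang X P i j) (sumSq X s) := by
  rw [commute_iff_eq, ang, sub_mul, mul_sub, mul_assoc, mul_assoc, h.P_mul_sumSq hi,
    h.P_mul_sumSq hj, mul_sub, mul_sub, ← mul_assoc, ← mul_assoc, ← mul_assoc, ← mul_assoc,
    (h.X_commute_sumSq i).eq, (h.X_commute_sumSq j).eq, mul_smul_comm, mul_smul_comm,
    (h.X_comm i j).eq]
  abel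

theorem ang_commute_sumSq_P (h : WeylRel ε X P ρ) {i j : n} (hi : i ∈ s) (hj : j ∈ s) :
    Commute (ang X P i j) (sumSq P s) := by
  rw [commute_iff_eq, ang, sub_mul, mul_sub, ← mul_assoc, ← mul_assoc, h.sumSq_mul_X hi,
    h.sumSq_mul_X hj, sub_mul, sub_mul, mul_assoc, mul_assoc, mul_assoc, mul_assoc,
    (h.P_commute_sumSq i).eq, (h.P_commute_sumSq j).eq, smul_mul_assoc, smul_mul_assoc,
    (h.P_comm i j).eq]
  abel

theorem ang_commute_dil (h : WeylRel ε X P ρ) {i j : n} (hi : i ∈ s) (hj : j ∈ s) :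
    Commute (ang X P i j) (dil ε X P s) := by
  rw [commute_iff_eq, ang, sub_mul, mul_sub, ← mul_assoc, ← mul_assoc, h.dil_mul_X hi,
    h.dil_mul_X hj, sub_mul, sub_mul, smul_mul_assoc, smul_mul_assoc]
  have e : ∀ k ∈ s, P k * dil ε X P s = dil ε X P s * P k - ε • P k := fun k hk => by
    rw [h.dil_mul_P hk]; abel
  rw [mul_assoc, mul_assoc, mul_assoc, mul_assoc, e i hi, e j hj, mul_sub, mul_sub, mul_smul_comm,
    mul_smul_comm]

theorem ang_commute_rho (h : WeylRel ε X P ρ) (i j : n) : Commute (ang X P i j) ρ := by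
  have hX : X i * (X j * (ρ * (ρ * ρ))) = X j * (X i * (ρ * (ρ * ρ))) := by
    rw [← mul_assoc, (h.X_comm i j).eq, mul_assoc]
  have hρ : ∀ k l, X k * (ρ * P l) = ρ * (X k * P l) := fun k l => by
    rw [← mul_assoc, (h.X_rho k).eq, mul_assoc]
  rw [commute_iff_eq, ang, sub_mul, mul_sub, mul_assoc, mul_assoc, h.P_rho, h.P_rho,
    mul_add, mul_add, mul_smul_comm, mul_smul_comm, hX, hρ, hρ]
  abel

/-- The quantum form of Lagrange's identity `∑ L_ij² = 2(x²p² - (x·p)²)`; reordering produces the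
term linear in `∑ x_j p_j`. -/
theorem sum_ang_sq (h : WeylRel ε X P ρ) : ∑ i ∈ s, ∑ j ∈ s, ang X P i j ^ 2
    = (2 : ℂ) • (sumSq X s * sumSq P s - (∑ j ∈ s, X j * P j) ^ 2
        + ((s.card - 2) * ε) • ∑ j ∈ s, X j * P j) := by
  -- The expression valid for `i ≠ j` does not vanish on the diagonal although `L_ii = 0`; the last
  -- term compensates for this.
  have key : ∀ i j : n, ang X P i j ^ 2
      = X i ^ 2 * P j ^ 2 + X j ^ 2 * P i ^ 2 - (X i * P i) * (X j * P j)
        - (X j * P j) * (X i * P i) + ε • (X i * P i) + ε • (X j * P j)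
        - if i = j then (4 * ε) • (X i * P i) else 0 := by
    intro i j
    have hPX : ∀ k l, ∀ x : A, P k * (X l * x)
        = X l * (P k * x) - (if k = l then ε else 0 : ℂ) • x := fun k l x => by
      rw [← mul_assoc, h.P_X, sub_mul, mul_assoc, smul_mul_assoc, one_mul]
    have hXX' : ∀ x : A, X j * (X i * x) = X i * (X j * x) := fun x => by
      rw [← mul_assoc, (h.X_comm j i).eq, mul_assoc]
    by_cases hij : i = j
    · subst hij
      simp only [ang, sq, sub_mul, mul_sub, mul_assoc, hPX, mul_smul_comm, if_true]
      module
    · simp only [ang, sq, sub_mul, mul_sub, mul_assoc, hPX, (h.P_comm i j).eq, hXX', mul_smul_comm, hij, Ne.symm hij, if_false, if_true]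
      module
  have e1 : ∑ i ∈ s, ∑ j ∈ s, X i ^ 2 * P j ^ 2 = sumSq X s * sumSq P s := by
    rw [sumSq, sumSq, Finset.sum_mul_sum]
  have e2 : ∑ i ∈ s, ∑ j ∈ s, X j ^ 2 * P i ^ 2 = sumSq X s * sumSq P s := by
    rw [Finset.sum_comm, e1]
  have e3 : ∑ i ∈ s, ∑ j ∈ s, X i * P i * (X j * P j) = (∑ j ∈ s, X j * P j) ^ 2 := by
    rw [sq, Finset.sum_mul_sum]
  have e4 : ∑ i ∈ s, ∑ j ∈ s, X j * P j * (X i * P i) = (∑ j ∈ s, X j * P j) ^ 2 := by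
    rw [Finset.sum_comm, e3]
  simp only [key, Finset.sum_add_distrib, Finset.sum_sub_distrib, Finset.sum_ite_eq, e1, e2, e3, e4]
  rw [Finset.sum_congr rfl fun i hi => if_pos hi]
  simp only [Finset.sum_const, ← Nat.cast_smul_eq_nsmul ℂ, ← Finset.smul_sum]
  module

/-- This reduces commuting with a Casimir element to commuting with the angular momenta in the same
variables. -/
theorem cas_eq (h : WeylRel ε X P ρ) : cas ε X P s
    = (1 / 2 : ℂ) • ∑ i ∈ s, ∑ j ∈ s, ang X P i j ^ 2
      - (s.card * (s.card / 4 - 1) * ε ^ 2) • 1 := by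
  rw [cas, h.sumSq_mul_sumSq, h.sum_ang_sq, dil_eq]
  simp only [sq, sub_mul, mul_sub, smul_mul_assoc, mul_smul_comm, one_mul, mul_one]
  module

theorem cas_commute_of_ang (h : WeylRel ε X P ρ) {a : A}
    (ha : ∀ i ∈ s, ∀ j ∈ s, Commute (ang X P i j) a) : Commute (cas ε X P s) a := by
  rw [h.cas_eq]
  exact ((Commute.sum_left _ _ _ fun i hi => Commute.sum_left _ _ _ fun j hj =>
    (ha i hi j hj).pow_left 2).smul_left _).sub_left ((Commute.one_left a).smul_left _)

/-- A rotation generator in the variables `s ⊆ t` preserves `J_-`, `J_+` and `J_3` over `t`, hence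
the Casimir element over `t`. -/
theorem cas_commute_cas (h : WeylRel ε X P ρ) (hst : s ⊆ t) :
    Commute (cas ε X P s) (cas ε X P t) :=
  h.cas_commute_of_ang fun i hi j hj => by
    have h1 := h.ang_commute_sumSq_X (hst hi) (hst hj)
    have h2 := h.ang_commute_sumSq_P (hst hi) (hst hj)
    exact (((h2.mul_right h1).add_right (h1.mul_right h2)).smul_right _).sub_right
      ((h.ang_commute_dil (hst hi) (hst hj)).pow_right 2)

end WeylRel

end Weyl

/-! ### Radial reduction and the ladder argument -/

section Ladder

variable {A n : Type*} [Ring A] [Algebra ℂ A] [Fintype n] [DecidableEq n]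

/-- The relations of `M = i L`, for a square root `L` of `C + ħ²`, with the radial variables, and the
shift relations of the ladder operators in the direction `j`. -/
structure RootRel (ε : ℂ) (X P : n → A) (ρ M : A) (j : n) : Prop where
  M_rho : Commute M ρ
  M_sumSq : Commute M (sumSq X .univ)
  M_dil : Commute M (dil ε X P .univ)
  sq : -(M * M) = cas ε X P .univ - (ε * ε) • 1
  up : M * (M * X j - X j * dil ε X P .univ + sumSq X .univ * P j)
    = (M * X j - X j * dil ε X P .univ + sumSq X .univ * P j) * (M + ε • 1)
  down : M * (X j * M + X j * dil ε X P .univ - sumSq X .univ * P j + ε • X j)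
    = (X j * M + X j * dil ε X P .univ - sumSq X .univ * P j + ε • X j) * (M - ε • 1)

variable {ε : ℂ} {X P : n → A} {ρ M : A}

namespace WeylRel

theorem rho_mul_rho_mul_sumSq (h : WeylRel ε X P ρ) : ρ * ρ * sumSq X .univ = 1 := h.rho_sq

-- `x_j J_3 - r² p_j` is, up to a multiple of `x_j`, a tangential derivative, so it does not see the
-- radius; the factor `1/r` makes it homogeneous of degree zero, so that it commutes with dilations
-- as well.
set_option linter.unusedSimpArgs false in
theorem radial_commute (h : WeylRel ε X P ρ) (j : n) :
    Commute (ρ * (X j * dil ε X P .univ - sumSq X .univ * P j)) (sumSq X .univ) ∧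
    Commute (ρ * (X j * dil ε X P .univ - sumSq X .univ * P j)) ρ ∧
    Commute (ρ * (X j * dil ε X P .univ - sumSq X .univ * P j)) (dil ε X P .univ) := by
  have e1 := h.dil_mul_sumSq (s := .univ)
  have e2 := h.dil_mul_rho
  have e3 := h.P_mul_sumSq (Finset.mem_univ j)
  have e4 := h.P_rho j
  have e5 := h.dil_mul_X (Finset.mem_univ j)
  have e6 := h.dil_mul_P (Finset.mem_univ j)
  have e7 : sumSq X .univ * X j = X j * sumSq X .univ := (h.X_commute_sumSq j).eq.symm
  have e8 : ρ * X j = X j * ρ := (h.X_rho j).eq.symm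
  have e9 : sumSq X .univ * ρ = ρ * sumSq X .univ := h.rho_commute_sumSq.eq.symm
  have e0 : ρ * (ρ * sumSq X .univ) = 1 := by rw [← mul_assoc]; exact h.rho_sq
  set s := sumSq X .univ
  set J := dil ε X P .univ
  set x := X j
  set p := P j
  have e1' : ∀ y, J * (s * y) = s * (J * y) - (2 * ε) • (s * y) := fun y => by
    simpa only [sub_mul, mul_assoc, smul_mul_assoc] using congrArg (· * y) e1
  have e3' : ∀ y, p * (s * y) = s * (p * y) - (2 * ε) • (x * y) := fun y => by
    simpa only [sub_mul, mul_assoc, smul_mul_assoc] using congrArg (· * y) e3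
  have e5' : ∀ y, J * (x * y) = x * (J * y) - ε • (x * y) := fun y => by
    simpa only [sub_mul, mul_assoc, smul_mul_assoc] using congrArg (· * y) e5
  have e2' : ∀ y, J * (ρ * y) = ρ * (J * y) + ε • (ρ * y) := fun y => by
    simpa only [add_mul, mul_assoc, smul_mul_assoc] using congrArg (· * y) e2
  have e7' : ∀ y, s * (x * y) = x * (s * y) := fun y => by
    simpa only [mul_assoc] using congrArg (· * y) e7
  have e8' : ∀ y, ρ * (x * y) = x * (ρ * y) := fun y => by
    simpa only [mul_assoc] using congrArg (· * y) e8
  have e9' : ∀ y, s * (ρ * y) = ρ * (s * y) := fun y => by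
    simpa only [mul_assoc] using congrArg (· * y) e9
  have e0' : ∀ y, ρ * (ρ * (s * y)) = y := fun y => by
    rw [← mul_assoc ρ s, ← mul_assoc, e0, one_mul]
  refine ⟨?_, ?_, ?_⟩
  all_goals
    rw [commute_iff_eq]
    simp only [mul_add, mul_sub, sub_mul, smul_mul_assoc, mul_smul_comm, mul_assoc, smul_add,
      smul_sub, mul_one, e1, e2, e3, e4, e5, e6, e7, e8, e9, e1', e2', e3', e5', e7', e8',
      e9', e0, e0']
    try module

theorem radial_commute_X (h : WeylRel ε X P ρ) (j : n) :
    Commute (ρ * X j) (sumSq X .univ) ∧ Commute (ρ * X j) ρ ∧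
    Commute (ρ * X j) (dil ε X P .univ) := by
  refine ⟨h.rho_commute_sumSq.mul_left (h.X_commute_sumSq j),
    (Commute.refl ρ).mul_left (h.X_rho j), ?_⟩
  rw [commute_iff_eq, ← mul_assoc, h.dil_mul_rho, add_mul, mul_assoc, mul_assoc,
    h.dil_mul_X (Finset.mem_univ j), mul_sub, smul_mul_assoc, mul_smul_comm, sub_add_cancel]

end WeylRel

/-- The Hamiltonian in the radial variables `F, G, D` and `M = i L`. -/
def radialHam (μ : ℂ) (F G D M : A) : A := (1 / 2 : ℂ) • (F * F * (D * D - M * M)) - μ • G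

/-- The operator intertwining the radial Hamiltonians for `M` and `M + ε`. -/
def radialLadder (ε μ : ℂ) (F G D M : A) : A :=
  (M + (ε / 2) • 1) * (F * D) + M * (M + (ε / 2) • 1) * G + μ • 1

/-- An operator blind to the radial variables acts on `H(M)` only through the way it moves `M`. -/
theorem radialHam_mul {μ : ℂ} {F G D M M' Y : A} (hF : Commute Y F) (hG : Commute Y G)
    (hD : Commute Y D) (hM : M * Y = Y * M') :
    radialHam μ F G D M * Y = Y * radialHam μ F G D M' := by
  have hMM : M * M * Y = Y * (M' * M') := by rw [mul_assoc, hM, ← mul_assoc, hM, mul_assoc]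
  have h1 : F * F * (D * D - M * M) * Y = Y * (F * F * (D * D - M' * M')) := by
    rw [mul_assoc, sub_mul, hMM, ← (hD.mul_right hD).eq, ← mul_sub, ← mul_assoc,
      ← (hF.mul_right hF).eq, mul_assoc]
  rw [radialHam, radialHam, sub_mul, mul_sub Y, smul_mul_assoc, smul_mul_assoc, mul_smul_comm,
    mul_smul_comm, h1, hG.eq]

theorem radialHam_commute {F G D M : A} {ε q μ : ℂ} (hMF : Commute M F) (hMG : Commute M G)
    (hMD : Commute M D) (hFG : Commute G F) (hDF : D * F = F * D + ε • G)
    (hDG : D * G = G * D + ε • F) (hGG : G * G = F * F - q • 1) {U W : A}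
    (hUF : Commute U F) (hUG : Commute U G) (hUD : Commute U D) (hU : M * U = U * (M + ε • 1))
    (hWF : Commute W F) (hWG : Commute W G) (hWD : Commute W D) (hW : M * W = W * (M - ε • 1)) :
    Commute (radialHam μ F G D M) (U * radialLadder ε μ F G D M) ∧
    Commute (radialHam μ F G D M) (radialLadder ε μ F G D (-M - ε • 1) * W) := by
  have hone : ∀ y : A, Commute (ε • (1 : A)) y := fun y => (Commute.one_left y).smul_left ε
  constructor
  · rw [commute_iff_eq, ← mul_assoc, radialHam_mul hUF hUG hUD hU, mul_assoc, mul_assoc]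
    exact congrArg (U * ·) (intertwine hMF.eq hMG.eq hMD.eq hFG.eq hDF hDG hGG)
  -- The intertwining relation is used at `-M - ε`, whose shift by `ε` is `-M`; evenness of the
  -- Hamiltonian in `M` then turns `H(-M)` back into `H(M)`, and `W` carries `-M - ε` to `-M`.
  · have h := intertwine (μ := μ) (hMF.neg_left.sub_left (hone F)).eq
      (hMG.neg_left.sub_left (hone G)).eq (hMD.neg_left.sub_left (hone D)).eq hFG.eq hDF hDG hGG
    have hW' : (-M - ε • 1) * W = W * (-M) := by
      rw [sub_mul, neg_mul, hW, smul_mul_assoc, one_mul, mul_sub, mul_smul_comm, mul_one, mul_neg]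
      abel
    have hneg : radialHam μ F G D (-M) = radialHam μ F G D M := by simp [radialHam]
    rw [sub_add_cancel] at h
    have h' : radialHam μ F G D (-M) * radialLadder ε μ F G D (-M - ε • 1)
        = radialLadder ε μ F G D (-M - ε • 1) * radialHam μ F G D (-M - ε • 1) := by
      simpa only [radialHam, radialLadder] using h
    rw [commute_iff_eq, ← hneg, ← mul_assoc, h', mul_assoc, radialHam_mul hWF hWG hWD hW',
      mul_assoc]

/-- Expresses the operators built from `L` through `M = i L` and the radial variables. -/
theorem ladder_commute (h : WeylRel ε X P ρ) {j : n} {L : A} {ħ K μ r : ℂ}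
    (hε : ε = Complex.I * ħ) (hM : M = Complex.I • L) (hr : RootRel ε X P ρ M j) {H a a' U W : A}
    (hH : H = (1 / 2 : ℂ) • ((1 + K • sumSq X .univ) ^ 2 *
      (ρ ^ 2 * (dil ε X P .univ + ε • 1) ^ 2 + ρ ^ 2 * L ^ 2)) - μ • (ρ * (1 - K • sumSq X .univ)))
    (ha : a = r • (-((L + (ħ / 2) • 1) * (1 + K • sumSq X .univ) * ρ * (dil ε X P .univ + ε • 1))
      - Complex.I • (L * (L + (ħ / 2) • 1) * ρ * (1 - K • sumSq X .univ)))
      + (Complex.I * μ * r) • 1)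
    (ha' : a' = r • (-((L + (ħ / 2) • 1) * (1 + K • sumSq X .univ) * ρ * (dil ε X P .univ + ε • 1))
      + Complex.I • ((L + ħ • 1) * ρ * (L + (ħ / 2) • 1) * (1 - K • sumSq X .univ)))
      - (Complex.I * μ * r) • 1)
    (hU : U = L * (X j * ρ) + Complex.I • (ρ * (X j * dil ε X P .univ - sumSq X .univ * P j)))
    (hW : W = X j * ρ * L
      - Complex.I • (ρ * (X j * dil ε X P .univ - sumSq X .univ * P j + ε • X j))) :
    Commute H (U * a) ∧ Commute H (a' * W) := by
  obtain ⟨b1, b2, b3⟩ := h.radial_commute j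
  obtain ⟨c1, c2, c3⟩ := h.radial_commute_X j
  have d1 := h.dil_mul_sumSq (s := .univ)
  have d2 := h.dil_mul_rho
  have d3 : Commute ρ (sumSq X .univ) := h.rho_commute_sumSq
  have d4 : ρ * (ρ * sumSq X .univ) = 1 := by rw [← mul_assoc]; exact h.rho_sq
  have d5 := h.X_rho j
  have hhbar : ħ = -Complex.I * ε := by
    rw [hε, ← mul_assoc, neg_mul, Complex.I_mul_I, neg_neg, one_mul]
  have hL : L = (-Complex.I) • M := by
    rw [hM, smul_smul, neg_mul, Complex.I_mul_I, neg_neg, one_smul]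
  obtain ⟨m1, m2, m3, -, up, down⟩ := hr
  clear hε hM
  subst hhbar hL
  have hI := Complex.I_mul_I
  set s := sumSq X .univ
  set J := dil ε X P .univ
  set x := X j
  set p := P j
  obtain ⟨D, hD⟩ : ∃ D, D = J + ε • (1 : A) := ⟨_, rfl⟩
  obtain ⟨F, hF⟩ : ∃ F, F = ρ + K • (ρ * s) := ⟨_, rfl⟩
  obtain ⟨G, hG⟩ : ∃ G, G = ρ - K • (ρ * s) := ⟨_, rfl⟩
  have hone : ∀ y : A, Commute y (ε • (1 : A)) := fun y => (Commute.one_right y).smul_right ε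
  have comF : ∀ y : A, Commute y s → Commute y ρ → Commute y F := fun y h1 h2 => by
    rw [hF]; exact h2.add_right ((h2.mul_right h1).smul_right K)
  have comG : ∀ y : A, Commute y s → Commute y ρ → Commute y G := fun y h1 h2 => by
    rw [hG]; exact h2.sub_right ((h2.mul_right h1).smul_right K)
  have comD : ∀ y : A, Commute y J → Commute y D := fun y h1 => by
    rw [hD]; exact h1.add_right (hone y)
  have dρs : D * (ρ * s) = ρ * s * D - ε • (ρ * s) := by
    rw [hD, add_mul, ← mul_assoc, d2, add_mul, mul_assoc, d1]
    simp only [mul_add, mul_sub, mul_assoc, smul_mul_assoc, mul_smul_comm, mul_one, one_mul]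
    module
  have dρ : D * ρ = ρ * D + ε • ρ := by
    rw [hD, add_mul, d2]
    simp only [mul_add, smul_mul_assoc, mul_smul_comm, mul_one, one_mul]
  have hDF : D * F = F * D + ε • G := by
    rw [hF, hG, mul_add, mul_smul_comm, dρ, dρs, add_mul, smul_mul_assoc]
    module
  have hDG : D * G = G * D + ε • F := by
    rw [hF, hG, mul_sub, mul_smul_comm, dρ, dρs, sub_mul, smul_mul_assoc]
    module
  have hGF : Commute G F := comF G (by rw [hG]; exact d3.sub_left ((d3.mul_left (.refl s)).smul_left K))
    (by rw [hG]; exact (Commute.refl ρ).sub_left (((Commute.refl ρ).mul_left d3.symm).smul_left K))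
  -- `F² - G²` is four times the product of `1/r` and `K r²/r`.
  have hGG : G * G = F * F - (4 * K) • 1 := by
    rw [hF, hG]
    simp only [mul_add, mul_sub, add_mul, sub_mul, smul_mul_assoc, mul_smul_comm, mul_assoc,
      ← d3.eq, d4]
    module
  have hM1 : Commute M F := comF M m2 m1
  have hM2 : Commute M G := comG M m2 m1
  have hM3 : Commute M D := comD M m3
  have eF : (1 + K • s) * ρ = F := by rw [hF, add_mul, one_mul, smul_mul_assoc, d3.eq]
  have eG : ρ * (1 - K • s) = G := by rw [hG, mul_sub, mul_one, mul_smul_comm]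
  have eH : H = radialHam μ F G D M := by
    have e1 : (1 + K • s) ^ 2 * ρ ^ 2 = F * F := by
      have : Commute (1 + K • s) ρ := (Commute.one_left ρ).add_left (d3.symm.smul_left K)
      rw [← this.mul_pow, eF, pow_two]
    rw [hH, eG, ← hD, radialHam, ← mul_add, ← mul_assoc, e1, ← pow_two D, ← pow_two M, smul_pow,
      neg_sq, Complex.I_sq, neg_one_smul, ← sub_eq_add_neg]
  have eQ : (-Complex.I) • M + (-Complex.I * ε / 2) • 1 = (-Complex.I) • (M + (ε / 2) • 1) := by
    module
  have eQ' : (-Complex.I) • M + (-Complex.I * ε) • 1 = (-Complex.I) • (M + ε • 1) := by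
    module
  have ea : a = (r * Complex.I) • radialLadder ε μ F G D M := by
    rw [ha, ← hD, eQ, mul_assoc _ (1 + K • s) ρ, eF, mul_assoc _ ρ, eG, radialLadder]
    generalize M + (ε / 2) • 1 = Q
    simp only [smul_mul_assoc, mul_smul_comm, mul_assoc]
    match_scalars
    · ring
    · linear_combination (-r * Complex.I) * hI
    · ring
  -- The reflection `M ↦ -M - ε` changes the sign of `M + ε/2` and sends `M(M + ε/2)` to `(M + ε)(M
  -- + ε/2)`: exactly the passage from `A` to `A†`, up to an overall sign.
  have ea' : a' = (-(r * Complex.I)) • radialLadder ε μ F G D (-M - ε • 1) := by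
    have e1 : -M - ε • 1 + (ε / 2) • 1 = -(M + (ε / 2) • 1) := by module
    have e2 : -M - ε • 1 = -(M + ε • 1) := by abel
    have e3 : Commute ρ (M + (ε / 2) • 1) :=
      m1.symm.add_right ((Commute.one_right ρ).smul_right _)
    have e4 : (-Complex.I) • (M + ε • 1) * ρ * (-Complex.I) • (M + (ε / 2) • 1) * (1 - K • s)
        = -((M + ε • 1) * ((M + (ε / 2) • 1) * G)) := by
      have e5 : ρ * ((M + (ε / 2) • 1) * (1 - K • s)) = (M + (ε / 2) • 1) * G := by
        rw [← mul_assoc, e3.eq, mul_assoc, eG]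
      have e6 : (M + ε • 1) * (ρ * (M + (ε / 2) • 1)) * (1 - K • s)
          = (M + ε • 1) * ((M + (ε / 2) • 1) * G) := by rw [mul_assoc, mul_assoc ρ, e5]
      have e7 : -Complex.I * -Complex.I = -1 := by rw [neg_mul_neg, hI]
      rw [smul_mul_assoc, mul_smul_comm, smul_mul_assoc, smul_mul_assoc, smul_mul_assoc, smul_smul, e7,
        mul_assoc _ ρ, e6, neg_one_smul]
    rw [ha', ← hD, eQ, eQ', e4, mul_assoc _ (1 + K • s) ρ, eF, radialLadder, e1, e2]
    generalize M + (ε / 2) • 1 = Q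
    generalize M + ε • 1 = Q'
    simp only [smul_mul_assoc, mul_assoc, neg_mul, mul_neg, neg_neg]
    module
  have eU : U = (-Complex.I) • (M * (ρ * x) - ρ * (x * J - s * p)) := by
    rw [hU, d5.eq, smul_mul_assoc]
    module
  have eW : W = (-Complex.I) • (ρ * x * M + ρ * (x * J - s * p) + ε • (ρ * x)) := by
    rw [hW, d5.eq, mul_add ρ, mul_smul_comm, mul_smul_comm]
    module
  have up' : M * (M * (ρ * x) - ρ * (x * J - s * p))
      = (M * (ρ * x) - ρ * (x * J - s * p)) * (M + ε • 1) := by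
    have e : M * (ρ * x) - ρ * (x * J - s * p) = ρ * (M * x - x * J + s * p) := by
      rw [← mul_assoc, m1.eq, mul_assoc, ← mul_sub]
      congr 1
      abel
    rw [e, ← mul_assoc, m1.eq, mul_assoc, up, mul_assoc]
  have down' : M * (ρ * x * M + ρ * (x * J - s * p) + ε • (ρ * x))
      = (ρ * x * M + ρ * (x * J - s * p) + ε • (ρ * x)) * (M - ε • 1) := by
    have e : ρ * x * M + ρ * (x * J - s * p) + ε • (ρ * x)
        = ρ * (x * M + x * J - s * p + ε • x) := by
      simp only [mul_add, mul_sub, mul_assoc, mul_smul_comm]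
      abel
    rw [e, ← mul_assoc, m1.eq, mul_assoc, down, mul_assoc]
  have c4 : ∀ y : A, Commute (ρ * x) y → Commute (ρ * (x * J - s * p)) y → Commute M y →
      Commute (M * (ρ * x) - ρ * (x * J - s * p)) y := fun y h1 h2 h3 =>
    (h3.mul_left h1).sub_left h2
  have c5 : ∀ y : A, Commute (ρ * x) y → Commute (ρ * (x * J - s * p)) y → Commute M y →
      Commute (ρ * x * M + ρ * (x * J - s * p) + ε • (ρ * x)) y := fun y h1 h2 h3 =>
    ((h1.mul_left h3).add_left h2).add_left (h1.smul_left ε)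
  have key := radialHam_commute (μ := μ) hM1 hM2 hM3 hGF hDF hDG hGG
    (c4 F (comF _ c1 c2) (comF _ b1 b2) hM1) (c4 G (comG _ c1 c2) (comG _ b1 b2) hM2)
    (c4 D (comD _ c3) (comD _ b3) hM3) up'
    (c5 F (comF _ c1 c2) (comF _ b1 b2) hM1) (c5 G (comG _ c1 c2) (comG _ b1 b2) hM2)
    (c5 D (comD _ c3) (comD _ b3) hM3) down'
  rw [eH, ea, ea', eU, eW, smul_mul_assoc, mul_smul_comm, smul_mul_assoc, mul_smul_comm]
  exact ⟨(key.1.smul_right _).smul_right _, (key.2.smul_right _).smul_right _⟩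

end Ladder

/-! ### The Clifford square root of the Casimir element -/

section Slash

variable {A n : Type*} [Ring A] [Algebra ℂ A] [Fintype n] [DecidableEq n]

/-- Generators of a Clifford algebra that commute with positions, momenta and the radius. -/
structure CliffordRel (γ X P : n → A) (ρ : A) : Prop where
  anti : ∀ i j, γ i * γ j + γ j * γ i = if i = j then (2 : ℂ) • 1 else 0
  X_comm : ∀ i j, Commute (γ i) (X j)
  P_comm : ∀ i j, Commute (γ i) (P j)
  rho_comm : ∀ i, Commute (γ i) ρ

/-- The Feynman slash `∑ γ_j Y_j`. -/
def slash (γ Y : n → A) : A := ∑ j, γ j * Y j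

variable {ε : ℂ} {γ X P : n → A} {ρ : A}

theorem slash_mul_slash {A n : Type*} [Ring A] [Fintype n] {γ : n → A} {Y Z : n → A} (hY : ∀ i j, Commute (γ i) (Y j)) :
    slash γ Y * slash γ Z = ∑ i, ∑ j, γ i * γ j * (Y i * Z j) := by
  rw [slash, slash, Finset.sum_mul_sum]
  refine Finset.sum_congr rfl fun i _ => Finset.sum_congr rfl fun j _ => ?_
  rw [mul_assoc, ← mul_assoc (Y i), ← (hY j i).eq, mul_assoc, mul_assoc]

/-- Averaging the double sum with its transpose leaves only the anticommutators of the `γ_j`,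
because the `Y_j` commute. -/
theorem slash_sq (hγ : ∀ i j, γ i * γ j + γ j * γ i = if i = j then (2 : ℂ) • 1 else 0)
    {Y : n → A} (hY : ∀ i j, Commute (γ i) (Y j)) (hYY : ∀ i j, Commute (Y i) (Y j)) :
    slash γ Y * slash γ Y = sumSq Y .univ := by
  have e1 := slash_mul_slash (Z := Y) hY
  have e2 : slash γ Y * slash γ Y = ∑ i, ∑ j, γ j * γ i * (Y i * Y j) := by
    rw [e1, Finset.sum_comm]
    exact Finset.sum_congr rfl fun i _ => Finset.sum_congr rfl fun j _ => by rw [(hYY i j).eq]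
  have e3 : slash γ Y * slash γ Y + slash γ Y * slash γ Y = (2 : ℂ) • sumSq Y .univ := by
    nth_rewrite 1 [e1]
    rw [e2, ← Finset.sum_add_distrib, sumSq, Finset.smul_sum]
    refine Finset.sum_congr rfl fun i _ => ?_
    rw [← Finset.sum_add_distrib]
    simp only [← add_mul, hγ]
    simp [sq]
  have e4 : (2 : ℂ) • (slash γ Y * slash γ Y) = (2 : ℂ) • sumSq Y .univ := by rw [← e3, two_smul]
  simpa [smul_smul] using congrArg ((1 / 2 : ℂ) • ·) e4

namespace CliffordRel

theorem slash_add (hγ : CliffordRel γ X P ρ) (h : WeylRel ε X P ρ) :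
    dil ε X P .univ
      = (1 / 2 : ℂ) • (slash γ X * slash γ P + slash γ P * slash γ X) := by
  have e1 := slash_mul_slash (Z := P) hγ.X_comm
  have e2 : slash γ P * slash γ X
      = ∑ i, ∑ j, γ j * γ i * (X i * P j) - (Fintype.card n * ε) • 1 := by
    have : ∀ i j, γ j * γ i * (P j * X i)
        = γ j * γ i * (X i * P j) - if i = j then ε • 1 else 0 := fun i j => by
      rw [h.P_X, mul_sub, mul_smul_comm, mul_one]
      by_cases hij : i = j
      · subst hij
        have := hγ.anti i i
        rw [if_pos rfl, ← two_smul ℂ] at this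
        have : γ i * γ i = 1 := by simpa [smul_smul] using congrArg ((1 / 2 : ℂ) • ·) this
        simp [this]
      · simp [hij, Ne.symm hij]
    rw [slash_mul_slash hγ.P_comm, Finset.sum_comm]
    simp only [this, Finset.sum_sub_distrib]
    simp [← Nat.cast_smul_eq_nsmul ℂ, smul_smul]
  have e3 : ∑ i, ∑ j, γ i * γ j * (X i * P j) + ∑ i, ∑ j, γ j * γ i * (X i * P j)
      = (2 : ℂ) • ∑ i, X i * P i := by
    rw [← Finset.sum_add_distrib, Finset.smul_sum]
    refine Finset.sum_congr rfl fun i _ => ?_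
    rw [← Finset.sum_add_distrib]
    simp only [← add_mul, hγ.anti]
    simp
  rw [e1, e2, ← add_sub_assoc, e3, dil_eq, Finset.card_univ]
  module

/-- The trace term comes from `[x_i, p_i] = ε` and `γ_i² = 1`, once for each coordinate. It cancels
against the constant `ħ(N - 2)/2` in `L`, up to a remainder independent of `N`. -/
theorem slash_sub (hγ : CliffordRel γ X P ρ) (h : WeylRel ε X P ρ) :
    ∑ i, ∑ j, γ i * γ j * ang X P i j
      = slash γ X * slash γ P - slash γ P * slash γ X - (Fintype.card n * ε) • 1 := by
  have e1 := slash_mul_slash (Z := P) hγ.X_comm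
  have e4 := hγ.slash_add h
  have e5 : slash γ P * slash γ X = (2 : ℂ) • dil ε X P .univ - slash γ X * slash γ P := by
    rw [e4]; module
  have e3 : ∑ i, ∑ j, γ i * γ j * (X i * P j) + ∑ i, ∑ j, γ j * γ i * (X i * P j)
      = (2 : ℂ) • ∑ i, X i * P i := by
    rw [← Finset.sum_add_distrib, Finset.smul_sum]
    refine Finset.sum_congr rfl fun i _ => ?_
    rw [← Finset.sum_add_distrib]
    simp only [← add_mul, hγ.anti]
    simp
  have e6 : ∑ i, ∑ j, γ i * γ j * (X j * P i) = ∑ i, ∑ j, γ j * γ i * (X i * P j) :=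
    Finset.sum_comm
  rw [e5, dil_eq, Finset.card_univ]
  simp only [ang, mul_sub, Finset.sum_sub_distrib, e6, e1]
  rw [eq_sub_of_add_eq' e3]
  module

theorem slashRel (hγ : CliffordRel γ X P ρ) (h : WeylRel ε X P ρ) (j : n) :
    SlashRel ε (slash γ X) (slash γ P) (γ j) (X j) (P j) := by
  have hX := slash_sq hγ.anti hγ.X_comm h.X_comm
  have hP := slash_sq hγ.anti hγ.P_comm h.P_comm
  have cs : ∀ i, Commute (γ i) (sumSq X .univ) := fun i =>
    Commute.sum_right _ _ _ fun k _ => (hγ.X_comm i k).pow_right 2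
  have cp : ∀ i, Commute (γ i) (sumSq P .univ) := fun i =>
    Commute.sum_right _ _ _ fun k _ => (hγ.P_comm i k).pow_right 2
  refine ⟨?_, ?_, ?_, ?_, ?_, ?_, ?_, (hγ.X_comm j j).eq, (hγ.P_comm j j).eq, ?_, ?_, ?_⟩
  · rw [hX, ← mul_assoc, hX, slash, slash, Finset.sum_mul, Finset.mul_sum, Finset.smul_sum,
      ← Finset.sum_sub_distrib]
    refine Finset.sum_congr rfl fun i hi => ?_
    rw [mul_assoc, h.P_mul_sumSq hi, mul_sub, ← mul_assoc, (cs i).eq, mul_assoc, mul_smul_comm]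
  · rw [hP, ← mul_assoc, hP, slash, slash, Finset.sum_mul, Finset.mul_sum, Finset.smul_sum,
      ← Finset.sum_sub_distrib]
    refine Finset.sum_congr rfl fun i hi => ?_
    rw [← mul_assoc, ← (cp i).eq, mul_assoc, h.sumSq_mul_X hi, mul_sub, mul_assoc, mul_smul_comm]
  · exact Commute.sum_left _ _ _ fun i _ => (hγ.X_comm i j).mul_left (h.X_comm i j)
  · have : ∀ i, γ i * P i * X j = X j * (γ i * P i) - if i = j then ε • γ i else 0 := fun i => by
      rw [mul_assoc, h.P_X, mul_sub, ← mul_assoc, (hγ.X_comm i j).eq, mul_assoc, mul_smul_comm,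
        mul_one]
      split_ifs <;> simp
    simp [slash, Finset.sum_mul, Finset.mul_sum, this]
  · have : ∀ i, γ i * X i * P j = P j * (γ i * X i) + if j = i then ε • γ i else 0 := fun i => by
      rw [← mul_assoc, ← (hγ.P_comm i j).eq, mul_assoc, mul_assoc, h.P_X, mul_sub, mul_smul_comm,
        mul_one]
      split_ifs <;> simp
    simp [slash, Finset.sum_mul, Finset.mul_sum, this, Finset.sum_add_distrib]
  · exact Commute.sum_left _ _ _ fun i _ => (hγ.P_comm i j).mul_left (h.P_comm i j)
  · rw [h.P_X, if_pos rfl]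
  · have : ∀ i, γ i * X i * γ j = (if i = j then (2 : ℂ) • X i else 0) - γ j * (γ i * X i) :=
      fun i => by
        rw [mul_assoc, ← (hγ.X_comm j i).eq, ← mul_assoc, eq_sub_of_add_eq (hγ.anti i j), sub_mul,
          mul_assoc]
        split_ifs <;> simp
    simp [slash, Finset.sum_mul, Finset.mul_sum, this]
  · have : ∀ i, γ i * P i * γ j = (if i = j then (2 : ℂ) • P i else 0) - γ j * (γ i * P i) :=
      fun i => by
        rw [mul_assoc, ← (hγ.P_comm j i).eq, ← mul_assoc, eq_sub_of_add_eq (hγ.anti i j), sub_mul,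
          mul_assoc]
        split_ifs <;> simp
    simp [slash, Finset.sum_mul, Finset.mul_sum, this]
  · have := hγ.anti j j
    rw [if_pos rfl, ← two_smul ℂ] at this
    simpa [smul_smul] using congrArg ((1 / 2 : ℂ) • ·) this

theorem rootRel (hγ : CliffordRel γ X P ρ) (h : WeylRel ε X P ρ) (j : n) {M : A}
    (hM : M = (ε * (Fintype.card n - 2) / 2) • 1
      + (1 / 2 : ℂ) • ∑ i, ∑ j, γ i * γ j * ang X P i j) : RootRel ε X P ρ M j := by
  -- The terms in the dimension cancel, leaving the constant `-ε` required by `SlashRel.shift_up`.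
  have hM' : M = (1 / 2 : ℂ) • (slash γ X * slash γ P - slash γ P * slash γ X) - ε • 1 := by
    rw [hM, hγ.slash_sub h]
    module
  have hX := slash_sq hγ.anti hγ.X_comm h.X_comm
  have hP := slash_sq hγ.anti hγ.P_comm h.P_comm
  have hJ := hγ.slash_add h
  have hs := hγ.slashRel h j
  have key : ∀ y, (∀ i j, Commute (ang X P i j) y) → (∀ i, Commute (γ i) y) → Commute M y := by
    intro y h1 h2
    rw [hM]
    exact ((Commute.one_left y).smul_left _).add_left (Commute.smul_left
      (Commute.sum_left _ _ _ fun i _ => Commute.sum_left _ _ _ fun j _ =>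
        ((h2 i).mul_left (h2 j)).mul_left (h1 i j)) _)
  have hsh := hs.shift_up hM' hJ
  rw [hX] at hsh
  refine ⟨key _ h.ang_commute_rho hγ.rho_comm, key _ (fun i j =>
    h.ang_commute_sumSq_X (Finset.mem_univ i) (Finset.mem_univ j)) fun i =>
    Commute.sum_right _ _ _ fun k _ => (hγ.X_comm i k).pow_right 2, key _ (fun i j =>
    h.ang_commute_dil (Finset.mem_univ i) (Finset.mem_univ j)) fun i =>
    Commute.sum_right _ _ _ fun k _ => ((hγ.X_comm i k).mul_right (hγ.P_comm i k)).sub_right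
      ((Commute.one_right _).smul_right _), ?_, hsh.1, hsh.2⟩
  rw [sq_eq_casimir hs.baa hs.bba hM' hJ, cas, hX, hP, sq]

end CliffordRel

end Slash

/-! ### The scalar square root in the plane -/

section Plane

variable {A : Type*} [Ring A] [Algebra ℂ A] {ε : ℂ} {X P : Fin 2 → A} {ρ : A}

-- In two variables `x_0 J_3 - r² p_0 = L x_1`. So the shift operators are multiples of `L(x_0 + i
-- x_1)` and `(x_0 - i x_1)L`, and multiplication by `x_0 ± i x_1` changes angular momentum by one
-- unit.
set_option linter.unusedSimpArgs false in
theorem WeylRel.rootRel_plane (h : WeylRel ε X P ρ) {M : A} (hM : M = Complex.I • ang X P 0 1) :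
    RootRel ε X P ρ M 0 := by
  have m0 := Finset.mem_univ (0 : Fin 2)
  have m1 := Finset.mem_univ (1 : Fin 2)
  have hI := Complex.I_mul_I
  have z : X 0 * dil ε X P .univ - sumSq X .univ * P 0 = ang X P 0 1 * X 1 := by
    simp only [dil_eq, sumSq, ang, Fin.sum_univ_two, Finset.card_univ, Fintype.card_fin, sub_mul,
      mul_sub, mul_add, add_mul, mul_assoc, h.P_X, sq, mul_smul_comm, mul_one, if_pos, zero_ne_one,
      if_false, zero_smul, mul_zero]
    module
  have l0 : ang X P 0 1 * X 0 = X 0 * ang X P 0 1 + ε • X 1 := by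
    have e2 : ∀ y, X 1 * (X 0 * y) = X 0 * (X 1 * y) := fun y => by
      rw [← mul_assoc, (h.X_comm 1 0).eq, mul_assoc]
    simp [ang, sub_mul, mul_sub, mul_assoc, h.P_X, e2]
    abel
  have l1 : ang X P 0 1 * X 1 = X 1 * ang X P 0 1 - ε • X 0 := by
    have e2 : ∀ y, X 1 * (X 0 * y) = X 0 * (X 1 * y) := fun y => by
      rw [← mul_assoc, (h.X_comm 1 0).eq, mul_assoc]
    simp [ang, sub_mul, mul_sub, mul_assoc, h.P_X, e2]
    abel
  have sq : ang X P 0 1 * ang X P 0 1 = cas ε X P .univ - (ε * ε) • 1 := by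
    have e1 : ang X P 1 0 = -ang X P 0 1 := by rw [ang, ang, neg_sub]
    have e2 : ∀ i, ang X P i i = 0 := fun i => sub_self _
    rw [h.cas_eq]
    simp [Fin.sum_univ_two, e1, e2, _root_.sq]
    module
  have key : ∀ y, Commute (ang X P 0 1) y → Commute M y := fun y h1 => by
    rw [hM]; exact h1.smul_left _
  refine ⟨key _ (h.ang_commute_rho 0 1), key _ (h.ang_commute_sumSq_X m0 m1),
    key _ (h.ang_commute_dil m0 m1), ?_, ?_, ?_⟩
  · rw [← sq, hM, smul_mul_smul_comm, hI, neg_one_smul, neg_neg]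
  · have e : M * X 0 - X 0 * dil ε X P .univ + sumSq X .univ * P 0
        = Complex.I • (ang X P 0 1 * X 0) - ang X P 0 1 * X 1 := by
      rw [← z, hM, smul_mul_assoc]
      abel
    rw [e, hM]
    generalize ang X P 0 1 = L at *
    have l0' : ∀ y, L * (X 0 * y) = X 0 * (L * y) + ε • (X 1 * y) := fun y => by
      rw [← mul_assoc, l0, add_mul, mul_assoc, smul_mul_assoc]
    have l1' : ∀ y, L * (X 1 * y) = X 1 * (L * y) - ε • (X 0 * y) := fun y => by
      rw [← mul_assoc, l1, sub_mul, mul_assoc, smul_mul_assoc]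
    simp only [mul_add, mul_sub, sub_mul, add_mul, smul_mul_assoc, mul_smul_comm, mul_assoc,
      mul_one, l0, l1, l0', l1']
    match_scalars <;>
      first | ring1 | linear_combination ε * hI | linear_combination (-ε ^ 2) * hI
  · have e : X 0 * M + X 0 * dil ε X P .univ - sumSq X .univ * P 0 + ε • X 0
        = Complex.I • (X 0 * ang X P 0 1) + X 1 * ang X P 0 1 := by
      rw [hM, mul_smul_comm, add_sub_assoc, z, l1]
      abel
    rw [e, hM]
    generalize ang X P 0 1 = L at *
    have l0' : ∀ y, L * (X 0 * y) = X 0 * (L * y) + ε • (X 1 * y) := fun y => by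
      rw [← mul_assoc, l0, add_mul, mul_assoc, smul_mul_assoc]
    have l1' : ∀ y, L * (X 1 * y) = X 1 * (L * y) - ε • (X 0 * y) := fun y => by
      rw [← mul_assoc, l1, sub_mul, mul_assoc, smul_mul_assoc]
    simp only [mul_add, mul_sub, sub_mul, add_mul, smul_mul_assoc, mul_smul_comm, mul_assoc,
      mul_one, l0, l1, l0', l1']
    match_scalars <;>
      first | ring1 | linear_combination ε * hI

end Plane

/-! ### The Hamiltonian in terms of the square root, and its commutation with Casimir elements -/

section Hamiltonian

variable {A n : Type*} [Ring A] [Algebra ℂ A] [Fintype n] [DecidableEq n]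
  {ε : ℂ} {X P : n → A} {ρ M : A}

/-- Reordering the Casimir element gives `J_- J_+ = (J_3 + ε)² + L²`; dividing by `J_-` splits the
kinetic energy into radial and angular parts. -/
theorem RootRel.sumSq_P (h : WeylRel ε X P ρ) {j : n} (hr : RootRel ε X P ρ M j) {L : A}
    (hM : M = Complex.I • L) :
    sumSq P .univ = ρ ^ 2 * (dil ε X P .univ + ε • 1) ^ 2 + ρ ^ 2 * L ^ 2 := by
  have e1 : L ^ 2 = -(M * M) := by
    rw [hM, smul_mul_smul_comm, Complex.I_mul_I, neg_one_smul, neg_neg, pow_two]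
  have e2 : (dil ε X P .univ + ε • 1) ^ 2 + L ^ 2 = sumSq X .univ * sumSq P .univ := by
    rw [e1, hr.sq, cas, h.sumSq_mul_sumSq, pow_two, pow_two]
    simp only [add_mul, mul_add, smul_mul_assoc, mul_smul_comm, one_mul, mul_one]
    module
  rw [← mul_add, e2, ← mul_assoc, pow_two, h.rho_mul_rho_mul_sumSq, one_mul]

theorem WeylRel.cas_commute_ham (h : WeylRel ε X P ρ) (s : Finset n) (K μ : ℂ) :
    Commute ((1 / 2 : ℂ) • ((1 + K • sumSq X .univ) ^ 2 * sumSq P .univ)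
      - μ • (ρ * (1 - K • sumSq X .univ))) (cas ε X P s) := by
  refine (h.cas_commute_of_ang fun i _ j _ => ?_).symm
  have h1 := h.ang_commute_sumSq_X (Finset.mem_univ i) (Finset.mem_univ j)
  have h2 := h.ang_commute_sumSq_P (Finset.mem_univ i) (Finset.mem_univ j)
  have h3 : Commute (ang X P i j) 1 := Commute.one_right _
  exact ((((h3.add_right (h1.smul_right K)).pow_right 2).mul_right h2).smul_right _).sub_right
    (((h.ang_commute_rho i j).mul_right (h3.sub_right (h1.smul_right K))).smul_right μ)

theorem commute_smul_sub {H a b : A} (ha : Commute H a) (hb : Commute H b) (c : ℂ) :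
    Commute H (c • (a - b)) :=
  (ha.sub_right hb).smul_right c

theorem I_smul_sub_smul (ħ m : ℂ) (S : A) :
    Complex.I • ((ħ * (m - 2) / 2) • 1 - (Complex.I / 2) • S)
      = (Complex.I * ħ * (m - 2) / 2) • 1 + (1 / 2 : ℂ) • S := by
  match_scalars
  · ring
  · linear_combination (-1 / 2 : ℂ) * Complex.I_mul_I

end Hamiltonian

/-! ### The Hamiltonian and its integrals as operators -/

section Operators

variable {N : ℕ} {V : Type*} [NormedAddCommGroup V] [NormedSpace ℂ V] (ħ k μ : ℝ)

theorem weylRel : WeylRel (Complex.I * ħ) (X : Fin N → Op N V) (P ħ) rInv where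
  X_comm := X_commute
  P_comm := P_commute ħ
  X_rho := X_commute_rInv
  P_X := P_mul_X ħ
  P_rho := P_mul_rInv ħ
  rho_sq := rInv_mul_rInv_mul_Jminus

theorem cliffordRel {γ : Fin N → V →L[ℂ] V} (hγ : IsClifford γ) :
    CliffordRel (fun i => constOp (γ i)) (X : Fin N → Op N V) (P ħ) rInv where
  anti i j := by
    rw [← constOp_mul, ← constOp_mul, ← constOp_add, hγ i j]
    split_ifs
    · refine Op.ext_apply fun ψ x _ => ?_
      have h2 : (2 : V →L[ℂ] V) = 1 + 1 := one_add_one_eq_two.symm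
      simp [h2, two_smul]
    · exact Op.ext_apply fun ψ x _ => by simp
  X_comm i j := constOp_commute_X _ j
  P_comm i j := constOp_commute_P ħ _ j
  rho_comm i := constOp_commute_rInv _

theorem hamiltonian_commute_casimir (s : Finset (Fin N)) :
    Commute (hamiltonian ħ k μ : Op N V) (casimir ħ s) :=
  (weylRel ħ).cas_commute_ham s _ _

theorem casimir_commute_casimir {s t : Finset (Fin N)} (hst : s ⊆ t) :
    Commute (casimir ħ s : Op N V) (casimir ħ t) :=
  (weylRel ħ).cas_commute_cas hst

section Root

variable {L : Op N V} {j : Fin N}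

theorem hamiltonian_eq_hamiltonianOf
    (hr : RootRel (Complex.I * ħ) X (P ħ) rInv (Complex.I • L) j) :
    hamiltonian ħ k μ = hamiltonianOf ħ k μ L := by
  have h := hr.sumSq_P (weylRel ħ) rfl
  have h' : Jplus ħ .univ = rInv ^ 2 * J3shift ħ ^ 2 + rInv ^ 2 * L ^ 2 := h
  rw [hamiltonian, hamiltonianOf, h']

theorem hamiltonian_commute_ladder
    (hr : RootRel (Complex.I * ħ) X (P ħ) rInv (Complex.I • L) j) :
    Commute (hamiltonian ħ k μ) (Lplus ħ L j * ladderA ħ k μ L) ∧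
    Commute (hamiltonian ħ k μ) (ladderAdag ħ k μ L * Lminus ħ L j) := by
  rw [hamiltonian_eq_hamiltonianOf ħ k μ hr]
  exact ladder_commute (K := (k ^ 2 : ℂ)) (μ := μ) (r := (Real.sqrt 2 : ℂ)⁻¹) (ħ := ħ)
    (weylRel ħ) rfl rfl hr rfl rfl rfl rfl rfl

theorem hamiltonian_commute_Rplus
    (hr : RootRel (Complex.I * ħ) X (P ħ) rInv (Complex.I • L) j) :
    Commute (hamiltonian ħ k μ) (Rplus ħ k μ L j) :=
  ((hamiltonian_commute_ladder ħ k μ hr).1.add_right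
    (hamiltonian_commute_ladder ħ k μ hr).2).smul_right _

theorem hamiltonian_commute_Rminus
    (hr : RootRel (Complex.I * ħ) X (P ħ) rInv (Complex.I • L) j) :
    Commute (hamiltonian ħ k μ) (Rminus ħ k μ L j) :=
  commute_smul_sub (A := Op N V) (hamiltonian_commute_ladder ħ k μ hr).1
    (hamiltonian_commute_ladder ħ k μ hr).2 (Real.sqrt 2 * Complex.I : ℂ)⁻¹

end Root

theorem totalAngMom_rootRel {γ : Fin N → V →L[ℂ] V} (hγ : IsClifford γ) (j : Fin N) :
    RootRel (Complex.I * ħ) X (P ħ) rInv (Complex.I • totalAngMom ħ γ : Op N V) j := by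
  refine (cliffordRel ħ hγ).rootRel (weylRel ħ) j ?_
  rw [Fintype.card_fin]
  exact I_smul_sub_smul (A := Op N V) (ħ : ℂ) (N : ℂ) _

theorem angMom_rootRel :
    RootRel (Complex.I * ħ) X (P ħ) rInv (Complex.I • angMom ħ 0 1 : Op 2 V) 0 :=
  (weylRel ħ).rootRel_plane rfl

end Operators

/-! ### Symbols with respect to a one-parameter family of automorphisms -/

section Symbol

open Polynomial

variable {A : Type*} [Ring A] [Algebra ℂ A]

theorem sum_map_toMultiset {ι : Type*} (w : ι → ℕ) (m : ι →₀ ℕ) :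
    ((Finsupp.toMultiset m).map w).sum = Finsupp.weight w m := by
  induction m using Finsupp.induction_linear with
  | zero => simp
  | add f g hf hg => simp [hf, hg]
  | single a n => simp [Finsupp.weight_single, Multiset.map_nsmul, Multiset.sum_nsmul]

theorem prod_map_toMultiset {ι : Type*} (y : ι → ℂ) (m : ι →₀ ℕ) :
    ((Finsupp.toMultiset m).map y).prod = m.prod fun i e => y i ^ e := by
  induction m using Finsupp.induction_linear with
  | zero => simp
  | add f g hf hg =>
    classical
    rw [Finsupp.prod_add_index' (by simp) (by simp [pow_add]), ← hf, ← hg]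
    simp
  | single a n => simp [Multiset.map_nsmul, Multiset.prod_nsmul]

/-- `Φ τ D` is a polynomial in `τ` of degree at most `d`, and `S` is its coefficient of `τ ^ d`. -/
def HasSym (Φ : ℝ → A →ₐ[ℂ] A) (d : ℕ) (D S : A) : Prop :=
  ∃ p : A[X], p.natDegree ≤ d ∧ p.coeff d = S ∧ ∀ τ : ℝ, Φ τ D = p.eval (algebraMap ℂ A τ)

namespace HasSym

variable {Φ : ℝ → A →ₐ[ℂ] A} {d e : ℕ} {D E S T : A}

theorem of_fixed (h : ∀ τ, Φ τ D = D) : HasSym Φ 0 D D :=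
  ⟨C D, by simp, by simp, fun τ => by simp [h τ]⟩

theorem one : HasSym Φ 0 1 1 := of_fixed fun _ => map_one _

theorem of_linear (h : ∀ τ : ℝ, Φ τ D = D + (τ : ℂ) • S) : HasSym Φ 1 D S :=
  ⟨C D + C S * Polynomial.X, by compute_degree, by simp, fun τ => by
    rw [h τ, eval_add, eval_C, eval_mul_X, eval_C, ← Algebra.commutes, Algebra.smul_def]⟩

theorem add (h : HasSym Φ d D S) (h' : HasSym Φ d E T) : HasSym Φ d (D + E) (S + T) := by
  obtain ⟨p, h1, h2, h3⟩ := h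
  obtain ⟨q, h1', h2', h3'⟩ := h'
  exact ⟨p + q, natDegree_add_le_of_degree_le h1 h1', by rw [coeff_add, h2, h2'], fun τ => by
    rw [map_add, eval_add, h3, h3']⟩

theorem smul (c : ℂ) (h : HasSym Φ d D S) : HasSym Φ d (c • D) (c • S) := by
  obtain ⟨p, h1, h2, h3⟩ := h
  refine ⟨c • p, (natDegree_smul_le _ _).trans h1, by rw [coeff_smul, h2], fun τ => ?_⟩
  rw [map_smul, h3, eval_smul]

theorem neg (h : HasSym Φ d D S) : HasSym Φ d (-D) (-S) := by
  simpa using h.smul (-1)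

theorem sub (h : HasSym Φ d D S) (h' : HasSym Φ d E T) : HasSym Φ d (D - E) (S - T) := by
  simpa [sub_eq_add_neg] using h.add (h'.smul (-1))

/-- Evaluation of polynomials over a noncommutative ring is multiplicative here because the
evaluation points are central scalars. -/
theorem mul (h : HasSym Φ d D S) (h' : HasSym Φ e E T) : HasSym Φ (d + e) (D * E) (S * T) := by
  obtain ⟨p, h1, h2, h3⟩ := h
  obtain ⟨q, h1', h2', h3'⟩ := h'
  refine ⟨p * q, natDegree_mul_le_of_le h1 h1', ?_, fun τ => ?_⟩
  · rw [coeff_mul_add_eq_of_natDegree_le h1 h1', h2, h2']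
  · rw [map_mul, h3, h3', eval, eval, eval,
      eval₂_mul_noncomm _ _ fun k => (Algebra.commutes _ _).symm]

/-- This is how terms of lower order, such as the potential and the ordering corrections, drop out
of symbols. -/
theorem raise (h : HasSym Φ d D S) (hde : d < e) : HasSym Φ e D 0 := by
  obtain ⟨p, h1, -, h3⟩ := h
  exact ⟨p, h1.trans hde.le, coeff_eq_zero_of_natDegree_lt (h1.trans_lt hde), h3⟩

theorem zero : HasSym Φ d 0 0 := ⟨0, by simp, by simp, fun τ => by simp⟩

theorem finset_sum {κ : Type*} (s : Finset κ) {D S : κ → A} (h : ∀ i ∈ s, HasSym Φ d (D i) (S i)) :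
    HasSym Φ d (∑ i ∈ s, D i) (∑ i ∈ s, S i) := by
  classical
  induction s using Finset.induction_on with
  | empty => simpa using zero
  | insert a s ha ih =>
    rw [Finset.sum_insert ha, Finset.sum_insert ha]
    exact (h a (Finset.mem_insert_self a s)).add (ih fun i hi => h i (Finset.mem_insert_of_mem hi))

theorem multiset_sum {κ : Type*} (s : Multiset κ) {D S : κ → A}
    (h : ∀ i ∈ s, HasSym Φ d (D i) (S i)) : HasSym Φ d (s.map D).sum (s.map S).sum := by
  induction s using Multiset.induction_on with
  | empty => simpa using zero
  | cons a s ih =>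
    rw [Multiset.map_cons, Multiset.map_cons, Multiset.sum_cons, Multiset.sum_cons]
    exact (h a (Multiset.mem_cons_self a s)).add (ih fun i hi => h i (Multiset.mem_cons_of_mem hi))

theorem list_prod {κ : Type*} (l : List κ) {D S : κ → A} {w : κ → ℕ}
    (h : ∀ i, HasSym Φ (w i) (D i) (S i)) :
    HasSym Φ (l.map w).sum (l.map D).prod (l.map S).prod := by
  induction l with
  | nil => simpa using one
  | cons a l ih =>
    rw [List.map_cons, List.map_cons, List.map_cons, List.prod_cons, List.prod_cons, List.sum_cons]
    exact (h a).mul ih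

/-- Every linear functional turns the conjugates of `0` into a complex polynomial vanishing at all
real `τ`; its coefficients vanish, and functionals separate points. -/
theorem eq_zero (h : HasSym Φ d 0 S) : S = 0 := by
  obtain ⟨p, h1, rfl, h3⟩ := h
  rw [← Module.forall_dual_apply_eq_zero_iff ℂ]
  intro f
  let q : ℂ[X] := ∑ i ∈ Finset.range (d + 1), C (f (p.coeff i)) * Polynomial.X ^ i
  have hq : ∀ τ : ℝ, q.eval (τ : ℂ) = 0 := fun τ => by
    have h4 := congrArg f (h3 τ)
    rw [map_zero, map_zero, eval_eq_sum_range' (Nat.lt_succ_of_le h1), map_sum] at h4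
    rw [eval_finsetSum, h4]
    refine Finset.sum_congr rfl fun i _ => ?_
    rw [← map_pow, ← Algebra.commutes, ← Algebra.smul_def, map_smul, eval_mul, eval_C,
      eval_pow, eval_X, smul_eq_mul, mul_comm]
  have hq0 : q = 0 := by
    refine Polynomial.eq_zero_of_infinite_isRoot q (Set.Infinite.mono ?_
      (Set.infinite_range_of_injective Complex.ofReal_injective))
    rintro _ ⟨τ, rfl⟩
    exact hq τ
  have := congrArg (fun r => coeff r d) hq0
  rw [finsetSum_coeff, coeff_zero] at this
  rw [← this, Finset.sum_eq_single d]
  · rw [coeff_C_mul, coeff_X_pow_self, mul_one]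
  · intro i _ hi
    rw [coeff_C_mul, coeff_X_pow, if_neg (Ne.symm hi), mul_zero]
  · intro hd
    simp at hd

variable {ι : Type*} {B U : ι → A} {w : ι → ℕ}

theorem symMonomial (h : ∀ i, HasSym Φ (w i) (B i) (U i)) (m : ι →₀ ℕ) :
    HasSym Φ (Finsupp.weight w m) (symMonomial B m) (Bertrand.symMonomial U m) := by
  refine (multiset_sum _ fun l hl => ?_).smul _
  have h1 := list_prod l h
  have h2 : (l.map w).sum = Finsupp.weight w m := by
    rw [Multiset.mem_lists_iff] at hl
    have h3 : ((Finsupp.toMultiset m).map w).sum = (l.map w).sum := by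
      rw [hl]; simp
    rw [← h3, sum_map_toMultiset]
  rwa [h2] at h1

theorem symEval (h : ∀ i, HasSym Φ (w i) (B i) (U i)) (P : MvPolynomial ι ℂ) {d : ℕ}
    (hd : ∀ m ∈ P.support, Finsupp.weight w m ≤ d) :
    HasSym Φ d (symEval B P)
      (∑ m ∈ P.support with Finsupp.weight w m = d, P.coeff m • Bertrand.symMonomial U m) := by
  rw [Finset.sum_filter]
  refine finset_sum _ fun m hm => ?_
  have h1 := (symMonomial h m).smul (P.coeff m)
  split_ifs with h2
  · rwa [h2] at h1
  · exact h1.raise (lt_of_le_of_ne (hd m hm) h2)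

end HasSym

end Symbol

/-! ### Initial forms of polynomials along curves -/

section LeadingCoefficients

open Filter Topology

/-- The behaviour of a polynomial along curves with prescribed leading exponents. -/
theorem exists_initial_form {ι : Type*} {Q : MvPolynomial ι ℂ} (hQ : Q ≠ 0) (w : ι → ℕ) :
    ∃ R : MvPolynomial ι ℂ, R ≠ 0 ∧ ∀ (F : ℝ → ι → ℂ) (Y : ι → ℂ),
      (∀ i, Tendsto (fun u => F u i) (𝓝[>] 0) (𝓝 (Y i))) →
      (∀ᶠ u : ℝ in 𝓝[>] 0, MvPolynomial.eval (fun i => (u : ℂ) ^ w i * F u i) Q = 0) →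
      MvPolynomial.eval Y R = 0 := by
  obtain ⟨m₀, hm₀, hmin⟩ := Q.support.exists_min_image (Finsupp.weight w)
    (MvPolynomial.support_nonempty.2 hQ)
  set d := Finsupp.weight w m₀ with hd
  -- `R` is the part of lowest weight, which dominates as `u → 0+`.
  refine ⟨MvPolynomial.weightedHomogeneousComponent w d Q, fun h => ?_, fun F Y hF h0 => ?_⟩
  · have := congrArg (MvPolynomial.coeff m₀) h
    rw [MvPolynomial.coeff_weightedHomogeneousComponent, if_pos hd.symm] at this
    exact MvPolynomial.mem_support_iff.1 hm₀ this
  · have e1 : ∀ u : ℝ, MvPolynomial.eval (fun i => (u : ℂ) ^ w i * F u i) Q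
        = (u : ℂ) ^ d * ∑ m ∈ Q.support, Q.coeff m *
          ((u : ℂ) ^ (Finsupp.weight w m - d) * m.prod fun i e => F u i ^ e) := by
      intro u
      rw [MvPolynomial.eval_eq, Finset.mul_sum]
      refine Finset.sum_congr rfl fun m hm => ?_
      have h1 : ∏ i ∈ m.support, ((u : ℂ) ^ w i * F u i) ^ m i
          = (u : ℂ) ^ Finsupp.weight w m * m.prod fun i e => F u i ^ e := by
        rw [Finsupp.weight_apply, Finsupp.sum, ← Finset.prod_pow_eq_pow_sum, Finsupp.prod,
          ← Finset.prod_mul_distrib]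
        refine Finset.prod_congr rfl fun i _ => ?_
        rw [mul_pow, ← pow_mul, smul_eq_mul, mul_comm (w i)]
      rw [h1, ← pow_mul_pow_sub _ (hmin m hm)]
      ring
    have e2 : Tendsto (fun u : ℝ => ∑ m ∈ Q.support, Q.coeff m *
        ((u : ℂ) ^ (Finsupp.weight w m - d) * m.prod fun i e => F u i ^ e)) (𝓝[>] 0)
        (𝓝 (∑ m ∈ Q.support, Q.coeff m *
          ((0 : ℂ) ^ (Finsupp.weight w m - d) * m.prod fun i e => Y i ^ e))) := by
      refine tendsto_finsetSum _ fun m _ => ((Tendsto.pow ?_ _).mul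
        (tendsto_finsetProd _ fun i _ => (hF i).pow _)).const_mul _
      exact (Complex.continuous_ofReal.tendsto' 0 0 Complex.ofReal_zero).mono_left
        nhdsWithin_le_nhds
    have e3 : (fun u : ℝ => ∑ m ∈ Q.support, Q.coeff m *
        ((u : ℂ) ^ (Finsupp.weight w m - d) * m.prod fun i e => F u i ^ e))
        =ᶠ[𝓝[>] 0] fun _ => 0 := by
      filter_upwards [h0, self_mem_nhdsWithin] with u hu hu0
      rw [e1] at hu
      exact (mul_eq_zero.1 hu).resolve_left
        (pow_ne_zero _ (Complex.ofReal_ne_zero.2 (ne_of_gt hu0)))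
    have e4 := tendsto_nhds_unique (e2.congr' e3) tendsto_const_nhds
    rw [MvPolynomial.weightedHomogeneousComponent_apply, map_sum, Finset.sum_filter]
    refine (Finset.sum_congr rfl fun m hm => ?_).trans e4
    rw [MvPolynomial.eval_monomial]
    split_ifs with h2
    · rw [h2, Nat.sub_self, pow_zero, one_mul]
    · rw [zero_pow (Nat.sub_ne_zero_of_lt (lt_of_le_of_ne (hmin m hm) (Ne.symm h2))), zero_mul,
        mul_zero]

end LeadingCoefficients

/-! ### Symbols of operators on functions -/

section OpSymbol

variable {N : ℕ} {V : Type*} [NormedAddCommGroup V] [NormedSpace ℂ V]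

/-- Multiplication by `exp (τ ⟨ξ, x⟩)`. -/
def expOp (ξ : Fin N → ℝ) (τ : ℝ) : Op N V :=
  mulOp (fun x => Real.exp (τ * ∑ j, ξ j * x j)) (by fun_prop)

theorem expOp_mul_neg (ξ : Fin N → ℝ) (τ : ℝ) : (expOp ξ τ * expOp ξ (-τ) : Op N V) = 1 :=
  Op.ext_apply fun ψ x _ => by
    simp [expOp, smul_smul, ← Real.exp_add]

theorem expOp_neg_mul (ξ : Fin N → ℝ) (τ : ℝ) : (expOp ξ (-τ) * expOp ξ τ : Op N V) = 1 := by
  simpa using expOp_mul_neg (V := V) ξ (-τ)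

/-- Conjugation with the exponentials `exp (τ ⟨ξ, x⟩)`. -/
def expConj (ξ : Fin N → ℝ) (τ : ℝ) : Op N V →ₐ[ℂ] Op N V :=
  AlgHom.ofLinearMap
    { toFun := fun D => expOp ξ (-τ) * D * expOp ξ τ
      map_add' := fun D E => by rw [mul_add, add_mul]
      map_smul' := fun c D => by rw [mul_smul_comm, smul_mul_assoc]; rfl }
    (by simp [expOp_neg_mul])
    (fun D E => by
      change expOp ξ (-τ) * (D * E) * expOp ξ τ
        = expOp ξ (-τ) * D * expOp ξ τ * (expOp ξ (-τ) * E * expOp ξ τ)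
      have h := expOp_mul_neg (V := V) ξ τ
      calc expOp ξ (-τ) * (D * E) * expOp ξ τ
          = expOp ξ (-τ) * D * 1 * E * expOp ξ τ := by simp only [mul_assoc, mul_one]
        _ = _ := by rw [← h]; simp only [mul_assoc])

theorem expConj_apply (ξ : Fin N → ℝ) (τ : ℝ) (D : Op N V) :
    expConj ξ τ D = expOp ξ (-τ) * D * expOp ξ τ := rfl

theorem expConj_of_commute {ξ : Fin N → ℝ} {τ : ℝ} {D : Op N V} (h : Commute D (expOp ξ τ)) :
    expConj ξ τ D = D := by
  rw [expConj_apply, mul_assoc, h.eq, ← mul_assoc, expOp_neg_mul, one_mul]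

theorem hasSym_mulOp (ξ : Fin N → ℝ) (f : Space N → ℝ) (hf : ContDiffOn ℝ ∞ f {0}ᶜ) :
    HasSym (expConj ξ) 0 (mulOp f hf : Op N V) (mulOp f hf) :=
  HasSym.of_fixed fun _ => expConj_of_commute (mulOp_commute ..)

theorem hasSym_constOp (ξ : Fin N → ℝ) (T : V →L[ℂ] V) :
    HasSym (expConj ξ) 0 (constOp T : Op N V) (constOp T) :=
  HasSym.of_fixed fun _ => expConj_of_commute (constOp_commute_mulOp ..)

/-- The exponential is real, so `p_j` becomes `p_j - iħτ ξ_j`: the covector is purely imaginary. -/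
theorem hasSym_P (ħ : ℝ) (ξ : Fin N → ℝ) (j : Fin N) :
    HasSym (expConj ξ) 1 (P ħ j : Op N V) ((-Complex.I * ħ * ξ j : ℂ) • 1) := by
  refine HasSym.of_linear fun τ => ?_
  have hg : ContDiffOn ℝ ∞ (fun x : Space N => τ * ξ j * Real.exp (τ * ∑ j, ξ j * x j)) {0}ᶜ := by
    fun_prop
  have h := partialOp_mul_mulOp (V := V) j (f := fun x => Real.exp (τ * ∑ j, ξ j * x j))
    (by fun_prop) hg (fun x _ => by
      have h1 : HasFDerivAt (fun x : Space N => ∑ j, ξ j * x j)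
          (∑ j, ξ j • EuclideanSpace.proj (𝕜 := ℝ) j) x :=
        HasFDerivAt.fun_sum fun i _ => (EuclideanSpace.proj (𝕜 := ℝ) i).hasFDerivAt.const_mul (ξ i)
      rw [((h1.const_mul τ).exp).fderiv]
      simp
      ring)
  have h2 : (mulOp _ hg : Op N V) = (τ * ξ j : ℂ) • expOp ξ τ :=
    Op.ext_apply fun ψ x _ => by
      simp only [mulOp_apply, expOp, LinearMap.smul_apply, Submodule.coe_smul, Pi.smul_apply, mul_smul]
      simp only [Complex.coe_smul]
  rw [h2] at h
  rw [expConj_apply, P, mul_assoc, smul_mul_assoc]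
  change expOp ξ (-τ) * (-Complex.I * ħ) • (partialOp j * expOp ξ τ) = _
  change partialOp j * expOp ξ τ = expOp ξ τ * partialOp j + _ at h
  rw [h, mul_smul_comm, mul_add, ← mul_assoc, mul_smul_comm, expOp_neg_mul, one_mul, smul_add,
    smul_smul, smul_smul]
  congr 2
  ring

/-- At the point `x`, the operator `S` multiplies values in direction `v` by `y`. -/
def Eig (x : Space N) (v : V) (S : Op N V) (y : ℂ) : Prop :=
  ∀ (φ : Wave N V) (c : ℂ), φ.1 x = c • v → (S φ).1 x = (y * c) • v

/-- `D` has order at most `d`, and at `(x, ξ)` its symbol of order `d` multiplies `v` by `y`. -/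
def HasEig (x : Space N) (ξ : Fin N → ℝ) (v : V) (d : ℕ) (D : Op N V) (y : ℂ) : Prop :=
  ∃ S, HasSym (expConj ξ) d D S ∧ Eig x v S y

theorem Eig.add {x : Space N} {v : V} {S T : Op N V} {y z : ℂ} (h : Eig x v S y)
    (h' : Eig x v T z) : Eig x v (S + T) (y + z) := fun φ c hφ => by
  rw [add_mul, add_smul, ← h φ c hφ, ← h' φ c hφ]
  rfl

theorem Eig.smul {x : Space N} {v : V} {S : Op N V} {y : ℂ} (a : ℂ) (h : Eig x v S y) :
    Eig x v (a • S) (a * y) := fun φ c hφ => by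
  rw [mul_assoc, mul_smul, ← h φ c hφ]
  rfl

theorem Eig.mul {x : Space N} {v : V} {S T : Op N V} {y z : ℂ} (h : Eig x v S y)
    (h' : Eig x v T z) : Eig x v (S * T) (y * z) := fun φ c hφ => by
  rw [mul_assoc]
  exact h _ _ (h' φ c hφ)

theorem Eig.one {x : Space N} {v : V} : Eig x v (1 : Op N V) 1 := fun φ c hφ => by
  rw [one_mul, ← hφ]
  rfl

theorem Eig.zero {x : Space N} {v : V} : Eig x v (0 : Op N V) 0 := fun φ c _ => by
  rw [zero_mul, zero_smul]
  rfl

theorem Eig.finset_sum {x : Space N} {v : V} {κ : Type*} (s : Finset κ) {S : κ → Op N V} {y : κ → ℂ}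
    (h : ∀ i ∈ s, Eig x v (S i) (y i)) : Eig x v (∑ i ∈ s, S i) (∑ i ∈ s, y i) := by
  classical
  induction s using Finset.induction_on with
  | empty => exact Eig.zero
  | insert a s ha ih =>
    rw [Finset.sum_insert ha, Finset.sum_insert ha]
    exact (h a (Finset.mem_insert_self a s)).add (ih fun i hi => h i (Finset.mem_insert_of_mem hi))

theorem Eig.list_prod {x : Space N} {v : V} {κ : Type*} (l : List κ) {S : κ → Op N V} {y : κ → ℂ}
    (h : ∀ i, Eig x v (S i) (y i)) : Eig x v (l.map S).prod (l.map y).prod := by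
  induction l with
  | nil => exact Eig.one
  | cons a l ih => exact (h a).mul ih

theorem Eig.multiset_sum_const {x : Space N} {v : V} {κ : Type*} (s : Multiset κ) {S : κ → Op N V}
    {y : ℂ} (h : ∀ i ∈ s, Eig x v (S i) y) : Eig x v (s.map S).sum (s.card * y) := by
  induction s using Multiset.induction_on with
  | empty => simpa using Eig.zero
  | cons a s ih =>
    have := (h a (Multiset.mem_cons_self a s)).add
      (ih fun i hi => h i (Multiset.mem_cons_of_mem hi))
    rw [Multiset.map_cons, Multiset.sum_cons, Multiset.card_cons]
    convert this using 1
    push_cast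
    ring

/-- On a common eigenvector the order of the factors is immaterial, so the average over all
orderings is the ordinary monomial. The orderings are counted with repetition, which matches the
factorial. -/
theorem Eig.symMonomial {x : Space N} {v : V} {ι : Type*} {S : ι → Op N V} {y : ι → ℂ}
    (h : ∀ i, Eig x v (S i) (y i)) (m : ι →₀ ℕ) :
    Eig x v (symMonomial S m) (m.prod fun i e => y i ^ e) := by
  have h1 : ∀ l ∈ (Finsupp.toMultiset m).lists,
      Eig x v (l.map S).prod (m.prod fun i e => y i ^ e) := fun l hl => by
    rw [Multiset.mem_lists_iff] at hl
    have h3 : ((Finsupp.toMultiset m).map y).prod = (l.map y).prod := by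
      rw [hl]; simp
    rw [← prod_map_toMultiset, h3]
    exact list_prod l h
  have h2 : ((Finsupp.toMultiset m).lists.card : ℂ)
      = ((Finsupp.toMultiset m).card.factorial : ℂ) := by
    obtain ⟨l, hl⟩ := Quot.exists_rep (Finsupp.toMultiset m)
    rw [← hl]
    simp [Multiset.lists, List.length_permutations]
  have h4 := (Eig.multiset_sum_const _ h1).smul (((Finsupp.toMultiset m).card.factorial : ℂ)⁻¹)
  rwa [h2, inv_mul_cancel_left₀ (Nat.cast_ne_zero.2 (Nat.factorial_ne_zero _))] at h4

theorem exists_wave {x : Space N} (hx : x ≠ 0) (v : V) : ∃ φ : Wave N V, φ.1 x = v := by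
  classical
  refine ⟨⟨fun y => if y = 0 then 0 else v, ?_, if_pos rfl⟩, if_neg hx⟩
  exact (contDiffOn_const (c := v)).congr fun y hy => if_neg hy

/-- A symmetrized polynomial relation between operators restricts to a polynomial relation between
the eigenvalues of their symbols. -/
theorem exists_symbol_relation {ι : Type*} {S : ι → Op N V} {P : MvPolynomial ι ℂ} (hP : P ≠ 0)
    (h0 : symEval S P = 0) (w : ι → ℕ) :
    ∃ Q : MvPolynomial ι ℂ, Q ≠ 0 ∧ ∀ (x : Space N) (ξ : Fin N → ℝ) (v : V) (y : ι → ℂ),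
      x ≠ 0 → v ≠ 0 → (∀ i, HasEig x ξ v (w i) (S i) (y i)) → MvPolynomial.eval y Q = 0 := by
  obtain ⟨m₀, hm₀, hmax⟩ := P.support.exists_max_image (Finsupp.weight w)
    (MvPolynomial.support_nonempty.2 hP)
  -- The part of highest weight survives in the symbol. It is chosen before the point, the covector
  -- and the vector.
  refine ⟨MvPolynomial.weightedHomogeneousComponent w (Finsupp.weight w m₀) P, fun h => ?_, ?_⟩
  · have := congrArg (MvPolynomial.coeff m₀) h
    rw [MvPolynomial.coeff_weightedHomogeneousComponent, if_pos rfl] at this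
    exact MvPolynomial.mem_support_iff.1 hm₀ this
  · intro x ξ v y hx hv h
    choose σ h1 h2 using h
    have e1 := HasSym.symEval h1 P hmax
    rw [h0] at e1
    have e2 := e1.eq_zero
    obtain ⟨φ, hφ⟩ := exists_wave hx v
    have e3 := Eig.finset_sum ({m ∈ P.support | Finsupp.weight w m = Finsupp.weight w m₀})
      (fun m _ => (Eig.symMonomial h2 m).smul (P.coeff m)) φ 1 (by rw [hφ, one_smul])
    rw [e2, mul_one] at e3
    have e4 := (smul_eq_zero.1 e3.symm).resolve_right hv
    rw [MvPolynomial.weightedHomogeneousComponent_apply, map_sum, ← e4]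
    exact Finset.sum_congr rfl fun m _ => MvPolynomial.eval_monomial

open Filter Topology in
/-- A criterion for algebraic independence: the eigenvalues of the symbols along suitable curves have
independent leading coefficients. -/
theorem algIndep_of_curves {ι : Type*} [Finite ι] {S : ι → Op N V} (w w' : ι → ℕ) (T : ι → Set ℂ)
    (hT : ∀ i, (T i).Infinite)
    (h : ∀ Y ∈ Set.pi Set.univ T, ∃ F : ℝ → ι → ℂ,
      (∀ i, Tendsto (fun u => F u i) (𝓝[>] 0) (𝓝 (Y i))) ∧
      ∀ᶠ u : ℝ in 𝓝[>] 0, ∃ (x : Space N) (ξ : Fin N → ℝ) (v : V), x ≠ 0 ∧ v ≠ 0 ∧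
        ∀ i, HasEig x ξ v (w i) (S i) ((u : ℂ) ^ w' i * F u i)) :
    AlgIndep S := by
  intro P hP0
  by_contra hP
  obtain ⟨Q, hQ, hQ0⟩ := exists_symbol_relation hP hP0 w
  obtain ⟨R, hR, hR0⟩ := exists_initial_form hQ w'
  refine hR (MvPolynomial.funext_set T hT fun Y hY => ?_)
  obtain ⟨F, hF, hu⟩ := h Y hY
  rw [map_zero]
  refine hR0 F Y hF (hu.mono fun u => ?_)
  rintro ⟨x, ξ, v, hx, hv, hi⟩
  exact hQ0 x ξ v _ hx hv hi

end OpSymbol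

/-! ### Eigenvalues of the symbols of the integrals -/

theorem radius_relations {N : ℕ} {x : Space N} (hx : x ≠ 0) : (((‖x‖⁻¹ : ℝ) : ℂ) ^ 2 * ∑ i, (x i : ℂ) ^ 2 = 1) ∧
    ((Real.sqrt 2 : ℂ)⁻¹ ^ 2 = 1 / 2) := by
  constructor
  · have h : ‖x‖⁻¹ ^ 2 * ∑ i, x i ^ 2 = 1 := by
      rw [← EuclideanSpace.real_norm_sq_eq, ← mul_pow, inv_mul_cancel₀ (norm_ne_zero_iff.2 hx),
        one_pow]
    exact_mod_cast congrArg (Complex.ofReal) h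
  · rw [inv_pow, ← Complex.ofReal_pow, Real.sq_sqrt two_pos.le]
    norm_num

section Eigenvalues

variable {N : ℕ} {V : Type*} [NormedAddCommGroup V] [NormedSpace ℂ V]
  {x : Space N} {ξ : Fin N → ℝ} {v : V} {d e : ℕ} {D E : Op N V} {y z : ℂ}

theorem Eig.sub {S T : Op N V} (h : Eig x v S y) (h' : Eig x v T z) : Eig x v (S - T) (y - z) :=
  fun φ c hφ => by
    rw [sub_mul, sub_smul, ← h φ c hφ, ← h' φ c hφ]
    rfl

theorem Eig.neg {S : Op N V} (h : Eig x v S y) : Eig x v (-S) (-y) :=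
  fun φ c hφ => by
    rw [neg_mul, neg_smul, ← h φ c hφ]
    rfl

namespace HasEig

theorem congr (h : HasEig x ξ v d D y) (hd : d = e) (hy : y = z) : HasEig x ξ v e D z := by
  rwa [← hd, ← hy]

theorem add (h : HasEig x ξ v d D y) (h' : HasEig x ξ v d E z) :
    HasEig x ξ v d (D + E) (y + z) :=
  let ⟨_, h1, h2⟩ := h
  let ⟨_, h3, h4⟩ := h'
  ⟨_, h1.add h3, h2.add h4⟩

theorem sub (h : HasEig x ξ v d D y) (h' : HasEig x ξ v d E z) :
    HasEig x ξ v d (D - E) (y - z) :=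
  let ⟨_, h1, h2⟩ := h
  let ⟨_, h3, h4⟩ := h'
  ⟨_, h1.sub h3, h2.sub h4⟩

theorem neg (h : HasEig x ξ v d D y) : HasEig x ξ v d (-D) (-y) :=
  let ⟨S, h1, h2⟩ := h
  ⟨-S, h1.neg, h2.neg⟩

theorem smul (c : ℂ) (h : HasEig x ξ v d D y) : HasEig x ξ v d (c • D) (c * y) :=
  let ⟨_, h1, h2⟩ := h
  ⟨_, h1.smul c, h2.smul c⟩

theorem mul (h : HasEig x ξ v d D y) (h' : HasEig x ξ v e E z) :
    HasEig x ξ v (d + e) (D * E) (y * z) :=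
  let ⟨_, h1, h2⟩ := h
  let ⟨_, h3, h4⟩ := h'
  ⟨_, h1.mul h3, h2.mul h4⟩

theorem one : HasEig x ξ v 0 (1 : Op N V) 1 := ⟨1, HasSym.one, Eig.one⟩

theorem raise (h : HasEig x ξ v d D y) (hde : d < e) : HasEig x ξ v e D 0 :=
  let ⟨_, h1, _⟩ := h
  ⟨_, h1.raise hde, Eig.zero⟩

theorem add_lower (h : HasEig x ξ v d D y) (h' : HasEig x ξ v e E z) (hed : e < d) :
    HasEig x ξ v d (D + E) y :=
  (h.add (h'.raise hed)).congr rfl (add_zero y)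

theorem sub_lower (h : HasEig x ξ v d D y) (h' : HasEig x ξ v e E z) (hed : e < d) :
    HasEig x ξ v d (D - E) y :=
  (h.sub (h'.raise hed)).congr rfl (sub_zero y)

theorem sq (h : HasEig x ξ v d D y) : HasEig x ξ v (d + d) (D ^ 2) (y ^ 2) := by
  rw [pow_two, pow_two]
  exact h.mul h

theorem finset_sum {κ : Type*} (s : Finset κ) {D : κ → Op N V} {y : κ → ℂ}
    (h : ∀ i ∈ s, HasEig x ξ v d (D i) (y i)) : HasEig x ξ v d (∑ i ∈ s, D i) (∑ i ∈ s, y i) := by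
  classical
  induction s using Finset.induction_on with
  | empty => exact ⟨0, HasSym.zero, Eig.zero⟩
  | insert a s ha ih =>
    rw [Finset.sum_insert ha, Finset.sum_insert ha]
    exact (h a (Finset.mem_insert_self a s)).add (ih fun i hi => h i (Finset.mem_insert_of_mem hi))

theorem mulOp (f : Space N → ℝ) (hf : ContDiffOn ℝ ∞ f {0}ᶜ) :
    HasEig x ξ v 0 (mulOp f hf : Op N V) (f x) :=
  ⟨_, hasSym_mulOp ξ f hf, fun φ c hφ => by
    rw [mulOp_apply, hφ, ← Complex.coe_smul, smul_smul]⟩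

theorem X (j : Fin N) : HasEig x ξ v 0 (X j : Op N V) (x j) := mulOp _ _

theorem rInv : HasEig x ξ v 0 (rInv : Op N V) ((‖x‖⁻¹ : ℝ) : ℂ) := mulOp _ _

variable (ħ k μ : ℝ)

theorem P (j : Fin N) : HasEig x ξ v 1 (P ħ j : Op N V) (-Complex.I * ħ * ξ j) :=
  ⟨_, hasSym_P ħ ξ j, by simpa using Eig.one.smul (x := x) (v := v) (-Complex.I * ħ * ξ j)⟩

theorem Jminus (s : Finset (Fin N)) :
    HasEig x ξ v 0 (Jminus s : Op N V) (∑ j ∈ s, (x j : ℂ) ^ 2) :=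
  finset_sum s fun j _ => (X j).sq

theorem Jplus (s : Finset (Fin N)) :
    HasEig x ξ v 2 (Jplus ħ s : Op N V) ((-Complex.I * ħ) ^ 2 * ∑ j ∈ s, (ξ j : ℂ) ^ 2) := by
  rw [Finset.mul_sum]
  exact finset_sum s fun j _ => (P ħ j).sq.congr rfl (mul_pow _ _ _)

theorem J3 (s : Finset (Fin N)) :
    HasEig x ξ v 1 (J3 ħ s : Op N V) (-Complex.I * ħ * ∑ j ∈ s, (x j : ℂ) * ξ j) := by
  rw [Finset.mul_sum]
  exact finset_sum s fun j _ => ((((X j).mul (P ħ j)).congr (zero_add 1) rfl).sub_lower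
    (one.smul _) one_pos).congr rfl (by ring)

theorem casimir (s : Finset (Fin N)) : HasEig x ξ v 2 (casimir ħ s : Op N V)
    ((-Complex.I * ħ) ^ 2 * ((∑ j ∈ s, (x j : ℂ) ^ 2) * (∑ j ∈ s, (ξ j : ℂ) ^ 2)
      - (∑ j ∈ s, (x j : ℂ) * ξ j) ^ 2)) :=
  (((((Jplus ħ s).mul (Jminus s)).congr (add_zero 2) rfl).add
    (((Jminus s).mul (Jplus ħ s)).congr (zero_add 2) rfl)).smul (1 / 2)).sub (J3 ħ s).sq |>.congr
      rfl (by ring)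

theorem kinetic : HasEig x ξ v 0 (1 + (k ^ 2 : ℂ) • Bertrand.Jminus .univ : Op N V)
    (1 + k ^ 2 * ∑ j, (x j : ℂ) ^ 2) :=
  one.add ((Jminus _).smul _)

theorem potential : HasEig x ξ v 0 (1 - (k ^ 2 : ℂ) • Bertrand.Jminus .univ : Op N V)
    (1 - k ^ 2 * ∑ j, (x j : ℂ) ^ 2) :=
  one.sub ((Jminus _).smul _)

theorem hamiltonian : HasEig x ξ v 2 (hamiltonian ħ k μ : Op N V)
    ((-Complex.I * ħ) ^ 2 * (1 / 2 * ((1 + k ^ 2 * ∑ j, (x j : ℂ) ^ 2) ^ 2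
      * ∑ j, (ξ j : ℂ) ^ 2))) :=
  (((((kinetic k).sq.mul (Jplus ħ _)).congr (zero_add 2) rfl).smul (1 / 2)).sub_lower
    ((rInv.mul (potential k)).smul μ) two_pos).congr rfl (by ring)

theorem angMom (i j : Fin N) : HasEig x ξ v 1 (angMom ħ i j : Op N V)
    (-Complex.I * ħ * (x i * ξ j - x j * ξ i)) :=
  (((X i).mul (P ħ j)).sub ((X j).mul (P ħ i))).congr (zero_add 1) (by ring)

variable {L : Op N V} {l : ℂ} {j : Fin N}

/-- On the hyperplane `x_j = 0` the term containing `L` drops out, and the symbols of `L_j^+` and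
`L_j^-` are opposite multiples of `ξ_j`. -/
theorem Lplus (hL : HasEig x ξ v 1 L l) (hj : x j = 0) : HasEig x ξ v 1 (Lplus ħ L j)
    (-Complex.I * ((‖x‖⁻¹ : ℝ) * ((∑ i, (x i : ℂ) ^ 2) * (-Complex.I * ħ * ξ j)))) :=
  ((hL.mul ((X j).mul rInv)).add ((rInv.mul ((((X j).mul (J3 ħ _)).sub
    ((Jminus _).mul (P ħ j))))).smul Complex.I)).congr rfl (by rw [hj]; push_cast; ring)

theorem Lminus (hL : HasEig x ξ v 1 L l) (hj : x j = 0) : HasEig x ξ v 1 (Lminus ħ L j)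
    (Complex.I * ((‖x‖⁻¹ : ℝ) * ((∑ i, (x i : ℂ) ^ 2) * (-Complex.I * ħ * ξ j)))) :=
  ((((X j).mul rInv).mul hL).sub ((rInv.mul (((((X j).mul (J3 ħ _)).sub
    ((Jminus _).mul (P ħ j)))).add_lower ((X j).smul (Complex.I * ħ)) one_pos)).smul
      Complex.I)).congr rfl (by rw [hj]; push_cast; ring)

theorem J3shift : HasEig x ξ v 1 (J3shift ħ : Op N V) (-Complex.I * ħ * ∑ j, (x j : ℂ) * ξ j) :=
  (J3 ħ _).add_lower (one.smul _) one_pos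

theorem ladderA (hL : HasEig x ξ v 1 L l) : HasEig x ξ v 2 (ladderA ħ k μ L)
    ((Real.sqrt 2 : ℂ)⁻¹ * (-(l * (1 + k ^ 2 * ∑ j, (x j : ℂ) ^ 2) * (‖x‖⁻¹ : ℝ)
        * (-Complex.I * ħ * ∑ j, (x j : ℂ) * ξ j))
      - Complex.I * (l * l * (‖x‖⁻¹ : ℝ) * (1 - k ^ 2 * ∑ j, (x j : ℂ) ^ 2)))) := by
  have hL' : ∀ c : ℂ, HasEig x ξ v 1 (L + c • 1) l := fun c => hL.add_lower (one.smul c) one_pos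
  have h1 := ((((hL' (ħ / 2 : ℂ)).mul (kinetic k)).mul rInv).mul (J3shift ħ)).neg
  have h2 := (((hL.mul (hL' (ħ / 2 : ℂ))).mul rInv).mul (potential k)).smul Complex.I
  exact ((h1.sub h2).smul (Real.sqrt 2 : ℂ)⁻¹).add_lower (one.smul _) two_pos

theorem ladderAdag (hL : HasEig x ξ v 1 L l) : HasEig x ξ v 2 (ladderAdag ħ k μ L)
    ((Real.sqrt 2 : ℂ)⁻¹ * (-(l * (1 + k ^ 2 * ∑ j, (x j : ℂ) ^ 2) * (‖x‖⁻¹ : ℝ)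
        * (-Complex.I * ħ * ∑ j, (x j : ℂ) * ξ j))
      + Complex.I * (l * (‖x‖⁻¹ : ℝ) * l * (1 - k ^ 2 * ∑ j, (x j : ℂ) ^ 2)))) := by
  have hL' : ∀ c : ℂ, HasEig x ξ v 1 (L + c • 1) l := fun c => hL.add_lower (one.smul c) one_pos
  have h1 := ((((hL' (ħ / 2 : ℂ)).mul (kinetic k)).mul rInv).mul (J3shift ħ)).neg
  have h2 := ((((hL' ħ).mul rInv).mul (hL' (ħ / 2 : ℂ))).mul (potential k)).smul Complex.I
  exact ((h1.add h2).smul (Real.sqrt 2 : ℂ)⁻¹).sub_lower (one.smul _) two_pos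

/-- Since the symbols of `L_j^±` are opposite, the sum keeps the difference of the symbols of `A`
and `A†`, that is the term with `L²`; in `Rminus` the term with `J_3` survives instead. -/
theorem Rplus (hL : HasEig x ξ v 1 L l) (hx : x ≠ 0) (hj : x j = 0) :
    HasEig x ξ v 3 (Rplus ħ k μ L j)
      (-(l ^ 2 * (-Complex.I * ħ * ξ j) * (1 - k ^ 2 * ∑ i, (x i : ℂ) ^ 2))) := by
  obtain ⟨h1, h2⟩ := radius_relations hx
  refine ((((Lplus ħ hL hj).mul (ladderA ħ k μ hL)).add
    ((ladderAdag ħ k μ hL).mul (Lminus ħ hL hj))).smul (Real.sqrt 2 : ℂ)⁻¹).congr rfl ?_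
  generalize ∑ i, (x i : ℂ) ^ 2 = s at *
  generalize ((‖x‖⁻¹ : ℝ) : ℂ) = ρ at *
  generalize (Real.sqrt 2 : ℂ)⁻¹ = r at *
  generalize -Complex.I * ħ * (ξ j : ℂ) = η
  generalize -Complex.I * ħ * ∑ j, (x j : ℂ) * ξ j = J
  linear_combination (2 * r ^ 2 * ρ ^ 2 * s * η * l ^ 2 * (1 - k ^ 2 * s)) * Complex.I_sq
    - (2 * ρ ^ 2 * s * η * l ^ 2 * (1 - k ^ 2 * s)) * h2 - (η * l ^ 2 * (1 - k ^ 2 * s)) * h1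

theorem Rminus (hL : HasEig x ξ v 1 L l) (hx : x ≠ 0) (hj : x j = 0) :
    HasEig x ξ v 3 (Rminus ħ k μ L j)
      ((-Complex.I * ħ * ξ j) * l * (1 + k ^ 2 * ∑ i, (x i : ℂ) ^ 2)
        * (-Complex.I * ħ * ∑ i, (x i : ℂ) * ξ i)) := by
  obtain ⟨h1, h2⟩ := radius_relations hx
  refine ((((Lplus ħ hL hj).mul (ladderA ħ k μ hL)).sub
    ((ladderAdag ħ k μ hL).mul (Lminus ħ hL hj))).smul (Real.sqrt 2 * Complex.I : ℂ)⁻¹).congr rfl ?_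
  rw [mul_inv, Complex.inv_I]
  generalize ∑ i, (x i : ℂ) ^ 2 = s at *
  generalize ((‖x‖⁻¹ : ℝ) : ℂ) = ρ at *
  generalize (Real.sqrt 2 : ℂ)⁻¹ = r at *
  generalize -Complex.I * ħ * (ξ j : ℂ) = η
  generalize -Complex.I * ħ * ∑ j, (x j : ℂ) * ξ j = J
  linear_combination (-2 * r ^ 2 * ρ ^ 2 * s * η * l * (1 + k ^ 2 * s) * J) * Complex.I_sq
    + (2 * ρ ^ 2 * s * η * l * (1 + k ^ 2 * s) * J) * h2 + (η * l * (1 + k ^ 2 * s) * J) * h1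

end HasEig

end Eigenvalues

/-! ### Eigenvectors of the symbol of the total angular momentum -/

section CliffordSymbol

variable {A : Type*} [Ring A] [Algebra ℂ A] {n : Type*} [Fintype n]

/-- Clifford multiplication by a vector. -/
def cliffordVec (γ : n → A) (x : n → ℂ) : A := ∑ j, x j • γ j

variable {γ : n → A} {x y : n → ℂ}

theorem cliffordVec_mul (γ : n → A) (x y : n → ℂ) :
    cliffordVec γ x * cliffordVec γ y = ∑ i, ∑ j, (x i * y j) • (γ i * γ j) := by
  rw [cliffordVec, cliffordVec, Finset.sum_mul_sum]
  simp_rw [smul_mul_smul_comm]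

theorem cliffordVec_anticomm [DecidableEq n]
    (hγ : ∀ i j, γ i * γ j + γ j * γ i = if i = j then 2 else 0) (x y : n → ℂ) :
    cliffordVec γ x * cliffordVec γ y + cliffordVec γ y * cliffordVec γ x
      = (2 * ∑ j, x j * y j) • 1 := by
  rw [cliffordVec_mul, cliffordVec_mul γ y, Finset.sum_comm (f := fun i j => (y i * x j) • _),
    ← Finset.sum_add_distrib]
  simp_rw [← Finset.sum_add_distrib, mul_comm (y _) (x _), ← smul_add, hγ]
  have h2 : (2 : A) = (2 : ℂ) • 1 := by rw [Algebra.smul_def, mul_one, map_ofNat]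
  simp [h2, Finset.mul_sum, Finset.sum_smul, smul_smul, mul_comm]

theorem cliffordVec_sq [DecidableEq n]
    (hγ : ∀ i j, γ i * γ j + γ j * γ i = if i = j then 2 else 0) (x : n → ℂ) :
    cliffordVec γ x * cliffordVec γ x = (∑ j, x j ^ 2) • 1 := by
  have h := congrArg (fun a => (1 / 2 : ℂ) • a) (cliffordVec_anticomm hγ x x)
  simp only [smul_add, ← add_smul, smul_smul, ← pow_two] at h
  norm_num at h
  rw [← pow_two, h]
  congr 1
  ring

/-- For Clifford vectors `g` and `h` the scalar is the Gram determinant of the two vectors. -/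
theorem commutator_sq_of_anticomm {g h : A} {a b c : ℂ} (hg : g * g = a • 1) (hh : h * h = b • 1)
    (hgh : g * h + h * g = (2 * c) • 1) :
    ((-Complex.I / 2) • (g * h - h * g)) * ((-Complex.I / 2) • (g * h - h * g))
      = (a * b - c ^ 2) • 1 := by
  have e : h * g = (2 * c) • 1 - g * h := by rw [← hgh]; abel
  have e1 : (g * h) * (g * h) = (2 * c) • (g * h) - (a * b) • 1 := by
    calc (g * h) * (g * h) = g * (h * g) * h := by noncomm_ring
      _ = (2 * c) • (g * h) - (g * g) * (h * h) := by
        rw [e, mul_sub, sub_mul, mul_smul_comm, mul_one, smul_mul_assoc]; noncomm_ring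
      _ = _ := by rw [hg, hh, smul_mul_smul_comm, mul_one]
  have e2 : g * h - h * g = (2 : ℂ) • (g * h - c • 1) := by rw [e]; module
  rw [e2, smul_smul, smul_mul_smul_comm, sub_mul, mul_sub, mul_sub, e1]
  simp only [smul_mul_assoc, mul_smul_comm, one_mul, mul_one]
  have hI : (-Complex.I / 2 * 2) * (-Complex.I / 2 * 2) = -1 := by
    linear_combination Complex.I_mul_I
  rw [hI]
  module

theorem mul_commutator_of_sq {g h : A} {a : ℂ} (hg : g * g = a • 1) :
    ((-Complex.I / 2) • (g * h - h * g)) * g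
      = (-1 : ℂ) • (g * ((-Complex.I / 2) • (g * h - h * g))) := by
  have e : h * (g * g) = (g * g) * h := by rw [hg]; simp
  have e1 : (g * h - h * g) * g = (-1 : ℂ) • (g * (g * h - h * g)) := by
    rw [neg_one_smul, sub_mul, mul_sub, mul_assoc h, e]; noncomm_ring
  rw [smul_mul_assoc, e1, mul_smul_comm, smul_comm]

end CliffordSymbol

/-- As `T² = l²`, the vector `Tw + lw` is an eigenvector for `l` unless it vanishes. In that case
`Tw = -lw`, and `g`, which is injective and anticommutes with `T`, carries `w` to the eigenvalue
`l`. No finite dimension is needed and `l = 0` is allowed. -/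
theorem exists_eigenvector_of_sq {V : Type*} [NormedAddCommGroup V] [NormedSpace ℂ V]
    [Nontrivial V] {T g : V →L[ℂ] V} {a l : ℂ} (ha : a ≠ 0) (hg : g * g = a • 1)
    (hT : T * T = (l ^ 2) • 1) (hTg : T * g = (-1 : ℂ) • (g * T)) : ∃ v, v ≠ 0 ∧ T v = l • v := by
  obtain ⟨w, hw⟩ := exists_ne (0 : V)
  have hT' : ∀ u, T (T u) = (l ^ 2) • u := fun u => DFunLike.congr_fun hT u
  have hg' : ∀ u, g (g u) = a • u := fun u => DFunLike.congr_fun hg u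
  have hTg' : ∀ u, T (g u) = (-1 : ℂ) • g (T u) := fun u => DFunLike.congr_fun hTg u
  by_cases h : T w + l • w = 0
  · refine ⟨g w, fun h0 => ?_, ?_⟩
    · have := hg' w
      rw [h0, map_zero] at this
      exact (smul_ne_zero ha hw) this.symm
    · rw [hTg', eq_neg_of_add_eq_zero_left h, map_neg, map_smul]
      module
  · refine ⟨_, h, ?_⟩
    rw [map_add, map_smul, hT']
    module

section TotalAngMom

variable {N : ℕ} {V : Type*} [NormedAddCommGroup V] [NormedSpace ℂ V]

theorem hasSym_angMom (ħ : ℝ) (ξ : Fin N → ℝ) (i j : Fin N) :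
    HasSym (expConj ξ) 1 (angMom ħ i j : Op N V)
      (X i * ((-Complex.I * ħ * ξ j : ℂ) • 1) - X j * ((-Complex.I * ħ * ξ i : ℂ) • 1)) := by
  have h : ∀ i j, HasSym (expConj ξ) 1 (X i * P ħ j : Op N V) _ := fun i j =>
    (hasSym_mulOp ξ _ _).mul (hasSym_P ħ ξ j)
  exact (h i j).sub (h j i)

theorem Op.sum_apply {κ : Type*} (s : Finset κ) (D : κ → Op N V) (φ : Wave N V) (x : Space N) :
    ((∑ i ∈ s, D i) φ).1 x = ∑ i ∈ s, (D i φ).1 x := by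
  rw [LinearMap.sum_apply]
  change ((∑ i ∈ s, D i φ : Wave N V) : Space N → V) x = _
  rw [Submodule.coe_sum, Finset.sum_apply]

theorem hasEig_totalAngMom (ħ : ℝ) (γ : Fin N → V →L[ℂ] V) (x : Space N) (ξ : Fin N → ℝ) {v : V}
    {l : ℂ} (hv : ((-Complex.I / 2) •
      (cliffordVec γ (fun j => (x j : ℂ)) * cliffordVec γ (fun j => (ξ j : ℂ))
        - cliffordVec γ (fun j => (ξ j : ℂ)) * cliffordVec γ (fun j => (x j : ℂ)))) v = l • v) :
    HasEig x ξ v 1 (totalAngMom ħ γ) (-Complex.I * ħ * l) := by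
  have h : HasSym (expConj ξ) 1 (totalAngMom ħ γ) _ :=
    ((HasSym.one.smul _).raise one_pos).sub ((HasSym.finset_sum .univ fun j _ =>
      HasSym.finset_sum .univ fun l _ =>
        ((hasSym_constOp ξ (γ j)).mul (hasSym_constOp ξ (γ l))).mul (hasSym_angMom ħ ξ j l)).smul
          (Complex.I / 2))
  refine ⟨_, h, fun φ c hφ => ?_⟩
  have hterm : ∀ i j, ((constOp (γ i) * constOp (γ j) * (X i * ((-Complex.I * ħ * ξ j : ℂ) • 1)
      - X j * ((-Complex.I * ħ * ξ i : ℂ) • 1)) : Op N V) φ).1 x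
      = (-Complex.I * ħ) • ((x i : ℂ) * ξ j) • γ i (γ j (φ.1 x))
        - (-Complex.I * ħ) • ((ξ i : ℂ) * x j) • γ i (γ j (φ.1 x)) := fun i j => by
    change γ i (γ j (x i • (-Complex.I * ħ * ξ j : ℂ) • φ.1 x
      - x j • (-Complex.I * ħ * ξ i : ℂ) • φ.1 x)) = _
    simp only [← Complex.coe_smul, map_sub, map_smul, smul_smul]
    congr 2 <;> ring
  have hsum : ((∑ i, ∑ j, constOp (γ i) * constOp (γ j) * (X i * ((-Complex.I * ħ * ξ j : ℂ) • 1)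
      - X j * ((-Complex.I * ħ * ξ i : ℂ) • 1)) : Op N V) φ).1 x
      = (-Complex.I * ħ) • (cliffordVec γ (fun j => (x j : ℂ)) * cliffordVec γ (fun j => (ξ j : ℂ))
        - cliffordVec γ (fun j => (ξ j : ℂ)) * cliffordVec γ (fun j => (x j : ℂ))) (φ.1 x) := by
    simp only [Op.sum_apply, hterm, cliffordVec_mul, sub_apply, sum_apply, smul_apply,
      Finset.sum_sub_distrib, Finset.smul_sum, smul_sub]
    rfl
  have hmain : ∀ S : Op N V, (((0 : Op N V) - (Complex.I / 2) • S) φ).1 x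
      = -((Complex.I / 2) • (S φ).1 x) := fun S => zero_sub _
  rw [hmain, hsum, hφ, map_smul]
  rw [smul_apply] at hv
  rw [show (-Complex.I * ħ * l * c) • v = (-Complex.I * ħ * c) • l • v by module, ← hv]
  module

theorem exists_hasEig_totalAngMom [Nontrivial V] (ħ : ℝ) {γ : Fin N → V →L[ℂ] V}
    (hγ : IsClifford γ) {x : Space N} (hx : x ≠ 0) (ξ : Fin N → ℝ) {l : ℝ}
    (hl : l ^ 2 = (∑ j, x j ^ 2) * (∑ j, ξ j ^ 2) - (∑ j, x j * ξ j) ^ 2) :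
    ∃ v : V, v ≠ 0 ∧ HasEig x ξ v 1 (totalAngMom ħ γ) (-Complex.I * ħ * l) := by
  have ha : (∑ j, (x j : ℂ) ^ 2) ≠ 0 := by
    have : ∑ j, x j ^ 2 ≠ 0 := by
      rw [← EuclideanSpace.real_norm_sq_eq]
      exact pow_ne_zero 2 (norm_ne_zero_iff.2 hx)
    exact_mod_cast this
  have h1 := cliffordVec_sq hγ fun j => (x j : ℂ)
  have h2 := cliffordVec_sq hγ fun j => (ξ j : ℂ)
  have h3 := cliffordVec_anticomm hγ (fun j => (x j : ℂ)) fun j => (ξ j : ℂ)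
  have hl' : (l : ℂ) ^ 2 = (∑ j, (x j : ℂ) ^ 2) * (∑ j, (ξ j : ℂ) ^ 2)
      - (∑ j, (x j : ℂ) * ξ j) ^ 2 := by exact_mod_cast congrArg Complex.ofReal hl
  have h4 := commutator_sq_of_anticomm h1 h2 h3
  rw [← hl'] at h4
  obtain ⟨v, hv, h⟩ := exists_eigenvector_of_sq ha h1 h4 (mul_commutator_of_sq h1)
  exact ⟨v, hv, hasEig_totalAngMom ħ γ x ξ h⟩

end TotalAngMom

/-! ### Gram determinants along a family of curves -/

section Gram

/-- The Gram determinant of two vectors restricted to the coordinates in `s`. -/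
def gram {κ : Type*} (s : Finset κ) (a b : κ → ℝ) : ℝ :=
  (∑ i ∈ s, a i ^ 2) * (∑ i ∈ s, b i ^ 2) - (∑ i ∈ s, a i * b i) ^ 2

theorem gram_map {κ κ' : Type*} (s : Finset κ) (f : κ ↪ κ') (a b : κ' → ℝ) :
    gram (s.map f) a b = gram s (fun i => a (f i)) fun i => b (f i) := by
  simp only [gram, Finset.sum_map]

theorem gram_congr {κ : Type*} {s : Finset κ} {a b a' b' : κ → ℝ} (ha : ∀ i ∈ s, a i = a' i)
    (hb : ∀ i ∈ s, b i = b' i) : gram s a b = gram s a' b' := by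
  rw [gram, gram, Finset.sum_congr rfl fun i hi => congrArg (· ^ 2) (ha i hi),
    Finset.sum_congr rfl fun i hi => congrArg (· ^ 2) (hb i hi),
    Finset.sum_congr rfl fun i hi => congrArg₂ (· * ·) (ha i hi) (hb i hi)]

theorem gram_mul_mul {κ : Type*} (s : Finset κ) (a b : κ → ℝ) (c d : ℝ) :
    gram s (fun i => c * a i) (fun i => d * b i) = c ^ 2 * d ^ 2 * gram s a b := by
  simp only [gram, mul_pow, mul_mul_mul_comm c, ← Finset.mul_sum]
  ring

/-- Because of this the parameter `c` is invisible to the `C_(m)` and remains free to be fixed by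
`R_-`. -/
theorem gram_shear {κ : Type*} (s : Finset κ) (a b : κ → ℝ) (c : ℝ) :
    gram s a (fun i => c * a i + b i) = gram s a b := by
  have h1 : ∀ i, (c * a i + b i) ^ 2 = c ^ 2 * a i ^ 2 + 2 * c * (a i * b i) + b i ^ 2 :=
    fun i => by ring
  have h2 : ∀ i, a i * (c * a i + b i) = c * a i ^ 2 + a i * b i := fun i => by ring
  simp only [gram, h1, h2, Finset.sum_add_distrib, ← Finset.mul_sum]
  ring

variable (X Ξ : ℕ → ℝ) (c y u : ℝ)

/-- The transversal momenta, divided by `u`. -/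
def curveSlope (i : ℕ) : ℝ := c * X i + u ^ i * Ξ i

/-- The momenta: the coordinate `0` is `y`, the others are transversal. -/
def curveMom (i : ℕ) : ℝ := (if i = 0 then y else 0) + u * curveSlope X Ξ c u i

variable {X Ξ}

theorem sum_curveMom_sq (hX : X 0 = 0) (hΞ : Ξ 0 = 0) {m : ℕ} (hm : 0 < m) :
    ∑ i ∈ Finset.range m, curveMom X Ξ c y u i ^ 2
      = y ^ 2 + u ^ 2 * ∑ i ∈ Finset.range m, curveSlope X Ξ c u i ^ 2 := by
  have h : ∀ i, curveMom X Ξ c y u i ^ 2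
      = (if i = 0 then y ^ 2 else 0) + u ^ 2 * curveSlope X Ξ c u i ^ 2 := fun i => by
    by_cases hi : i = 0
    · simp [hi, curveMom, curveSlope, hX, hΞ]
    · simp [hi, curveMom, mul_pow]
  simp only [h, Finset.sum_add_distrib, ← Finset.mul_sum, Finset.sum_ite_eq', Finset.mem_range, hm,
    if_true]

theorem sum_mul_curveMom (hX : X 0 = 0) (s : Finset ℕ) :
    ∑ i ∈ s, u * X i * curveMom X Ξ c y u i = u ^ 2 * ∑ i ∈ s, X i * curveSlope X Ξ c u i := by
  rw [Finset.mul_sum]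
  refine Finset.sum_congr rfl fun i _ => ?_
  by_cases hi : i = 0
  · simp [hi, hX]
  · simp only [hi, curveMom, if_false]
    ring

/-- The Gram determinant in the first `m` coordinates, divided by `u ^ 2`. -/
def curveUp (X Ξ : ℕ → ℝ) (c y : ℝ) (m : ℕ) (u : ℝ) : ℝ :=
  y ^ 2 * (∑ i ∈ Finset.range m, X i ^ 2)
    + u ^ 2 * gram (Finset.range m) X (curveSlope X Ξ c u)

theorem gram_range (hX : X 0 = 0) (hΞ : Ξ 0 = 0) {m : ℕ} (hm : 0 < m) :
    gram (Finset.range m) (fun i => u * X i) (curveMom X Ξ c y u)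
      = u ^ 2 * curveUp X Ξ c y m u := by
  simp only [gram, curveUp, sum_curveMom_sq c y u hX hΞ hm, sum_mul_curveMom c y u hX, mul_pow,
    ← Finset.mul_sum]
  ring

/-- The Gram determinant in the coordinates from `a` to `n - 1`, divided by `u ^ (4 + 2 * a)`. -/
def curveDown (X Ξ : ℕ → ℝ) (a n : ℕ) (u : ℝ) : ℝ :=
  gram (Finset.Ico a n) X fun i => u ^ (i - a) * Ξ i

/-- After the shear the momenta carry `u^(1+a)` and the positions `u`; the Gram determinant is
quadratic in each. -/
theorem gram_Ico {a : ℕ} (ha : 0 < a) (n : ℕ) :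
    gram (Finset.Ico a n) (fun i => u * X i) (curveMom X Ξ c y u)
      = u ^ (4 + 2 * a) * curveDown X Ξ a n u := by
  have h : ∀ i ∈ Finset.Ico a n, curveMom X Ξ c y u i
      = u * (c * X i + u ^ a * (u ^ (i - a) * Ξ i)) := fun i hi => by
    obtain ⟨h1, -⟩ := Finset.mem_Ico.1 hi
    rw [curveMom, curveSlope, if_neg (by omega), zero_add, ← mul_assoc (u ^ a), ← pow_add,
      Nat.add_sub_cancel' h1]
  rw [gram_congr (fun _ _ => rfl) h, gram_mul_mul, gram_shear]
  have h2 := gram_mul_mul (Finset.Ico a n) X (fun i => u ^ (i - a) * Ξ i) 1 (u ^ a)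
  simp only [one_mul] at h2
  rw [h2, curveDown]
  ring

theorem curveUp_zero (m : ℕ) :
    curveUp X Ξ c y m 0 = y ^ 2 * ∑ i ∈ Finset.range m, X i ^ 2 := by
  simp [curveUp]

/-- The powers `u^(i - a)` remove every `Ξ_i` with `i > a` in the limit, so each `C_(m)` isolates a
single parameter. -/
theorem curveDown_zero {a n : ℕ} (han : a < n) :
    curveDown X Ξ a n 0 = Ξ a ^ 2 * ∑ i ∈ Finset.Ico (a + 1) n, X i ^ 2 := by
  have h : ∀ i ∈ Finset.Ico (a + 1) n, (0 : ℝ) ^ (i - a) = 0 := fun i hi => by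
    obtain ⟨h1, -⟩ := Finset.mem_Ico.1 hi
    exact zero_pow (by omega)
  have h1 : ∑ i ∈ Finset.Ico (a + 1) n, ((0 : ℝ) ^ (i - a) * Ξ i) ^ 2 = 0 :=
    Finset.sum_eq_zero fun i hi => by simp [h i hi]
  have h2 : ∑ i ∈ Finset.Ico (a + 1) n, X i * ((0 : ℝ) ^ (i - a) * Ξ i) = 0 :=
    Finset.sum_eq_zero fun i hi => by simp [h i hi]
  simp only [curveDown, gram, Finset.sum_eq_sum_Ico_succ_bot han, h1, h2, Nat.sub_self, pow_zero]
  ring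

theorem sum_mul_curveSlope_zero (hX : X 0 = 0) (s : Finset ℕ) :
    ∑ i ∈ s, X i * curveSlope X Ξ c 0 i = c * ∑ i ∈ s, X i ^ 2 := by
  rw [Finset.mul_sum]
  refine Finset.sum_congr rfl fun i _ => ?_
  by_cases hi : i = 0
  -- At `i = 0` the factor `u^i` is `1` even for `u = 0`; the term vanishes because `X 0 = 0`.
  · simp [hi, hX]
  · simp only [curveSlope, zero_pow hi]
    ring

@[fun_prop]
theorem continuous_curveSlope (i : ℕ) : Continuous fun u => curveSlope X Ξ c u i := by
  unfold curveSlope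
  fun_prop

@[fun_prop]
theorem continuous_curveUp (m : ℕ) : Continuous (curveUp X Ξ c y m) := by
  unfold curveUp gram
  fun_prop

@[fun_prop]
theorem continuous_curveDown (a n : ℕ) : Continuous (curveDown X Ξ a n) := by
  unfold curveDown gram
  fun_prop

end Gram

/-! ### Eigenvalues along the curves -/

section Curves

variable {N : ℕ} {V : Type*} [NormedAddCommGroup V] [NormedSpace ℂ V]

theorem map_filter_lt {m : ℕ} (hm : m ≤ N) :
    ({i : Fin N | i.val < m} : Finset (Fin N)).map Fin.valEmbedding = Finset.range m := by
  ext i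
  simp only [Finset.mem_map, Finset.mem_filter, Finset.mem_univ, true_and, Fin.valEmbedding_apply,
    Finset.mem_range]
  exact ⟨fun ⟨j, hj, h⟩ => h ▸ hj, fun h => ⟨⟨i, h.trans_le hm⟩, h, rfl⟩⟩

theorem map_filter_le_add (m : ℕ) :
    ({i : Fin N | N ≤ i.val + m} : Finset (Fin N)).map Fin.valEmbedding
      = Finset.Ico (N - m) N := by
  ext i
  simp only [Finset.mem_map, Finset.mem_filter, Finset.mem_univ, true_and, Fin.valEmbedding_apply,
    Finset.mem_Ico]
  exact ⟨fun ⟨j, hj, h⟩ => by omega, fun h => ⟨⟨i, h.2⟩, by simp only; omega, rfl⟩⟩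

theorem hasEig_casimir_gram {x : Space N} {ξ : Fin N → ℝ} {v : V} (ħ : ℝ) (s : Finset (Fin N)) :
    HasEig x ξ v 2 (casimir ħ s) ((-Complex.I * ħ) ^ 2 * (gram s x ξ : ℝ)) :=
  (HasEig.casimir ħ s).congr rfl (by rw [gram]; push_cast; rfl)

/-- The positions along the curve with parameter `u`. -/
def curvePos (N : ℕ) (X : ℕ → ℝ) (u : ℝ) : Space N := WithLp.toLp 2 fun i => u * X i

variable {X Ξ : ℕ → ℝ} {c y u : ℝ} {v : V} (ħ k μ : ℝ)

theorem sum_curvePos_sq : ∑ i : Fin N, curvePos N X u i ^ 2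
    = u ^ 2 * ∑ i ∈ Finset.range N, X i ^ 2 := by
  rw [← Fin.sum_univ_eq_sum_range (fun i => X i ^ 2), Finset.mul_sum]
  exact Finset.sum_congr rfl fun i _ => mul_pow _ _ _

theorem hasEig_casimirUp (hX : X 0 = 0) (hΞ : Ξ 0 = 0) {m : ℕ} (hm : 0 < m) (hmN : m ≤ N) :
    HasEig (curvePos N X u) (fun i => curveMom X Ξ c y u i) v 2 (casimirUp ħ m)
      ((-Complex.I * ħ) ^ 2 * (u ^ 2 * curveUp X Ξ c y m u : ℝ)) := by
  rw [← gram_range c y u hX hΞ hm, ← map_filter_lt hmN, gram_map]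
  exact hasEig_casimir_gram ħ _

theorem hasEig_casimirDown {m : ℕ} (hm : m < N) :
    HasEig (curvePos N X u) (fun i => curveMom X Ξ c y u i) v 2 (casimirDown ħ m)
      ((-Complex.I * ħ) ^ 2 * (u ^ (4 + 2 * (N - m)) * curveDown X Ξ (N - m) N u : ℝ)) := by
  rw [← gram_Ico c y u (Nat.sub_pos_of_lt hm), ← map_filter_le_add, gram_map]
  exact hasEig_casimir_gram ħ _

/-- The symbol of the Hamiltonian along the curve. -/
def curveHam (N : ℕ) (X Ξ : ℕ → ℝ) (c y k u : ℝ) : ℝ :=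
  1 / 2 * ((1 + k ^ 2 * (u ^ 2 * ∑ i ∈ Finset.range N, X i ^ 2)) ^ 2
    * (y ^ 2 + u ^ 2 * ∑ i ∈ Finset.range N, curveSlope X Ξ c u i ^ 2))

theorem hasEig_hamiltonian (hX : X 0 = 0) (hΞ : Ξ 0 = 0) (hN : 0 < N) :
    HasEig (curvePos N X u) (fun i => curveMom X Ξ c y u i) v 2 (hamiltonian ħ k μ : Op N V)
      ((-Complex.I * ħ) ^ 2 * (curveHam N X Ξ c y k u : ℝ)) := by
  refine (HasEig.hamiltonian ħ k μ).congr rfl ?_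
  rw [curveHam, ← sum_curvePos_sq, ← sum_curveMom_sq c y u hX hΞ hN, ← Fin.sum_univ_eq_sum_range]
  push_cast
  rfl

variable {L : Op N V} {j : Fin N} {θ : ℂ}

theorem hasEig_Rplus (hX : X 0 = 0) (hΞ : Ξ 0 = 0) (hj : j.val = 0) (hx : curvePos N X u ≠ 0)
    (hθ : θ ^ 2 = 1) (h0 : 0 ≤ curveUp X Ξ c y N u)
    (hL : HasEig (curvePos N X u) (fun i => curveMom X Ξ c y u i) v 1 L
      (-Complex.I * ħ * (θ * (u * √(curveUp X Ξ c y N u) : ℝ)))) :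
    HasEig (curvePos N X u) (fun i => curveMom X Ξ c y u i) v 3 (Rplus ħ k μ L j)
      (-(-Complex.I * ħ) ^ 3 * (u ^ 2 * (y * curveUp X Ξ c y N u
        * (1 - k ^ 2 * (u ^ 2 * ∑ i ∈ Finset.range N, X i ^ 2))) : ℝ)) := by
  refine (HasEig.Rplus ħ k μ hL hx (by simp [curvePos, hj, hX])).congr rfl ?_
  have h1 : curveMom X Ξ c y u j = y := by simp [curveMom, curveSlope, hj, hX, hΞ]
  have h2 : (√(curveUp X Ξ c y N u) : ℂ) ^ 2 = curveUp X Ξ c y N u := by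
    rw [← Complex.ofReal_pow, Real.sq_sqrt h0]
  rw [← sum_curvePos_sq, h1]
  push_cast
  rw [mul_pow, mul_pow θ, hθ, mul_pow (u : ℂ), h2]
  ring

theorem hasEig_Rminus (hX : X 0 = 0) (hΞ : Ξ 0 = 0) (hj : j.val = 0) (hx : curvePos N X u ≠ 0)
    (hL : HasEig (curvePos N X u) (fun i => curveMom X Ξ c y u i) v 1 L
      (-Complex.I * ħ * (θ * (u * √(curveUp X Ξ c y N u) : ℝ)))) :
    HasEig (curvePos N X u) (fun i => curveMom X Ξ c y u i) v 3 (Rminus ħ k μ L j)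
      ((-Complex.I * ħ) ^ 3 * θ * (u ^ 3 * (y * √(curveUp X Ξ c y N u)
        * (1 + k ^ 2 * (u ^ 2 * ∑ i ∈ Finset.range N, X i ^ 2))
        * ∑ i ∈ Finset.range N, X i * curveSlope X Ξ c u i) : ℝ)) := by
  refine (HasEig.Rminus ħ k μ hL hx (by simp [curvePos, hj, hX])).congr rfl ?_
  have h1 : curveMom X Ξ c y u j = y := by simp [curveMom, curveSlope, hj, hX, hΞ]
  have h2 : ∑ i : Fin N, (curvePos N X u i : ℂ) * (curveMom X Ξ c y u i : ℂ)
      = ((u ^ 2 * ∑ i ∈ Finset.range N, X i * curveSlope X Ξ c u i : ℝ) : ℂ) := by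
    rw [← sum_mul_curveMom c y u hX, ← Fin.sum_univ_eq_sum_range
      (fun i => u * X i * curveMom X Ξ c y u i)]
    push_cast
    exact Finset.sum_congr rfl fun i _ => by simp [curvePos]
  rw [h2, ← sum_curvePos_sq, h1]
  push_cast
  ring

end Curves

/-! ### Algebraic independence of the integrals -/

section Independence

open Filter Topology

variable {N : ℕ} {V : Type*} [NormedAddCommGroup V] [NormedSpace ℂ V]

/-- The constants `c i` absorb the powers of `-iħ` and signs, so that only real leading coefficients
have to be prescribed. -/
theorem algIndep_of_real_curves {ι : Type*} [Finite ι] {S : ι → Op N V} (w w' : ι → ℕ)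
    (c : ι → ℂ) (hc : ∀ i, c i ≠ 0) (a : ι → ℝ)
    (h : ∀ Y : ι → ℝ, (∀ i, Y i ∈ Set.Ioo (a i) (a i + 1)) → ∃ F : ι → ℝ → ℝ,
      (∀ i, Continuous (F i)) ∧ (∀ i, F i 0 = Y i) ∧ ∀ u : ℝ, 0 < u →
        ∃ (x : Space N) (ξ : Fin N → ℝ) (v : V), x ≠ 0 ∧ v ≠ 0 ∧
          ∀ i, HasEig x ξ v (w i) (S i) (c i * (u ^ w' i * F i u : ℝ))) :
    AlgIndep S := by
  refine algIndep_of_curves w w'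
    (fun i => (fun t : ℝ => c i * (t : ℂ)) '' Set.Ioo (a i) (a i + 1)) (fun i => ?_) fun Z hZ => ?_
  · refine (Set.Ioo_infinite (lt_add_one (a i))).image fun s _ t _ hst => ?_
    exact Complex.ofReal_injective (mul_left_cancel₀ (hc i) hst)
  · choose Y hY hYZ using fun i => hZ i (Set.mem_univ i)
    obtain ⟨F, hF, hF0, hu⟩ := h Y hY
    refine ⟨fun u i => c i * (F i u : ℂ), fun i => ?_, ?_⟩
    · rw [← hYZ i, ← hF0 i]
      exact (((Complex.continuous_ofReal.comp (hF i)).const_mul (c i)).tendsto 0).mono_left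
        nhdsWithin_le_nhds
    · filter_upwards [self_mem_nhdsWithin] with u hu0
      obtain ⟨x, ξ, v, hx, hv, hi⟩ := hu u hu0
      exact ⟨x, ξ, v, hx, hv, fun i => (hi i).congr rfl (by push_cast; ring)⟩

/-- The values lie in consecutive disjoint intervals, so they increase, and square roots of their
differences give the `X_i` up to the factor `1/y`. -/
theorem exists_seq_of_partial_sums {M : ℕ} {Y : Fin M → ℝ}
    (hY : ∀ m : Fin M, Y m ∈ Set.Ioo ((m : ℝ) + 1) ((m : ℝ) + 1 + 1)) {y : ℝ} (hy : 0 < y) :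
    ∃ X : ℕ → ℝ, X 0 = 0 ∧ (∀ i, 0 < X (i + 1)) ∧
      ∀ m : Fin M, y ^ 2 * ∑ i ∈ Finset.range (m + 2), X i ^ 2 = Y m := by
  -- Beyond `M` the midpoint of the corresponding interval is used, which makes `X` positive at
  -- every positive index.
  let G : ℕ → ℝ := fun m => if h : m < M then Y ⟨m, h⟩ else m + 3 / 2
  have hG : ∀ m : ℕ, (m : ℝ) + 1 < G m ∧ G m < m + 2 := fun m => by
    simp only [G]
    split_ifs with h
    · have := hY ⟨m, h⟩
      exact ⟨this.1, by linarith [this.2]⟩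
    · constructor <;> linarith
  let K : ℕ → ℝ := fun m => m.casesOn 0 G
  have hK : ∀ m, 0 < K (m + 1) - K m := fun m => by
    cases m with
    | zero => simpa [K] using (zero_lt_one.trans (by simpa using (hG 0).1) : (0 : ℝ) < G 0)
    | succ m =>
      have h1 := (hG (m + 1)).1
      have h2 := (hG m).2
      push_cast at h1
      change 0 < G (m + 1) - G m
      linarith
  refine ⟨fun i => i.casesOn 0 fun m => √(K (m + 1) - K m) / y, rfl,
    fun i => div_pos (Real.sqrt_pos.2 (hK i)) hy, fun m => ?_⟩
  rw [Finset.sum_range_succ']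
  simp only [div_pow, Real.sq_sqrt (hK _).le, ← Finset.sum_div, Finset.sum_range_sub]
  have h1 : K (m + 1) = Y m := by simp [K, G]
  rw [h1]
  change y ^ 2 * ((Y m - 0) / y ^ 2 + 0 ^ 2) = Y m
  field_simp
  ring

theorem curvePos_ne_zero (hN : 1 < N) {X : ℕ → ℝ} (hX : ∀ i, 0 < X (i + 1)) {u : ℝ} (hu : 0 < u) :
    curvePos N X u ≠ 0 := fun h => by
  have h1 : curvePos N X u ⟨1, hN⟩ = 0 := by rw [h]; rfl
  exact (mul_pos hu (hX 0)).ne' h1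

theorem gram_nonneg {κ : Type*} (s : Finset κ) (a b : κ → ℝ) : 0 ≤ gram s a b :=
  sub_nonneg.2 (Finset.sum_mul_sq_le_sq_mul_sq s a b)

theorem neg_I_mul_ne_zero {ħ : ℝ} (hħ : 0 < ħ) : -Complex.I * (ħ : ℂ) ≠ 0 :=
  mul_ne_zero (neg_ne_zero.2 Complex.I_ne_zero) (Complex.ofReal_ne_zero.2 hħ.ne')

/-- Here `c = 0` and `Ξ = 0` suffice: `H` has leading coefficient `½y²` in degree `0`, the `C^(m)`
have the partial sums in degree `2`. -/
theorem algIndep_hamiltonian_casimirUp [Nontrivial V] (hN : 2 ≤ N) {ħ : ℝ} (hħ : 0 < ħ) (k μ : ℝ) :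
    AlgIndep fun o : Option (Fin (N - 1)) =>
      o.elim (hamiltonian ħ k μ : Op N V) fun m => casimirUp ħ (m + 2) := by
  have hκ := neg_I_mul_ne_zero hħ
  obtain ⟨v, hv⟩ := exists_ne (0 : V)
  refine algIndep_of_real_curves (fun _ => 2) (fun o => o.elim 0 fun _ => 2)
    (fun _ => (-Complex.I * ħ) ^ 2) (fun _ => pow_ne_zero 2 hκ) (fun o => o.elim 0 fun m => m + 1)
    fun Y hY => ?_
  obtain ⟨y, hy, hyY⟩ : ∃ y : ℝ, 0 < y ∧ 1 / 2 * y ^ 2 = Y none := by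
    have h2 : 0 < 2 * Y none := mul_pos two_pos (hY none).1
    exact ⟨_, Real.sqrt_pos.2 h2, by rw [Real.sq_sqrt h2.le]; ring⟩
  obtain ⟨X, hX0, hX, hXY⟩ := exists_seq_of_partial_sums (fun m => hY (some m)) hy
  refine ⟨fun o => o.elim (curveHam N X 0 0 y k)
    fun m => curveUp X 0 0 y (m + 2), ?_, ?_, fun u hu =>
      ⟨curvePos N X u, fun i => curveMom X 0 0 y u i, v,
        curvePos_ne_zero hN hX hu, hv, ?_⟩⟩
  · rintro (_ | m)
    · change Continuous fun u => curveHam N X 0 0 y k u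
      unfold curveHam
      fun_prop
    · exact continuous_curveUp _ _ _
  · rintro (_ | m)
    · simpa [curveHam] using hyY
    · exact (curveUp_zero _ _ _).trans (hXY m)
  · rintro (_ | m)
    · exact (hasEig_hamiltonian ħ k μ hX0 rfl (by omega)).congr rfl (by simp)
    · exact hasEig_casimirUp ħ hX0 rfl (by omega) (by omega)

/-- The eigenvalue of `L` is required only where the curves run: `x_j = 0`, nonnegative coordinates,
`ξ_j > 0`. There the scalar `L` of the plane has a definite sign, recorded by `θ`, so both versions
of `L` are covered. -/
theorem algIndep_integrals (hN : 2 ≤ N) {ħ : ℝ} (hħ : 0 < ħ) (k μ : ℝ) {L : Op N V} {j : Fin N}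
    (hj : j.val = 0) {θ : ℂ} (hθ : θ ^ 2 = 1)
    (hL : ∀ (x : Space N) (ξ : Fin N → ℝ) (l : ℝ), x ≠ 0 → x j = 0 → (∀ i, 0 ≤ x i) → 0 < ξ j →
      0 ≤ l → l ^ 2 = gram .univ x ξ →
      ∃ v : V, v ≠ 0 ∧ HasEig x ξ v 1 L (-Complex.I * ħ * (θ * l))) :
    AlgIndep (integrals ħ k μ L j) := by
  have hκ := neg_I_mul_ne_zero hħ
  have hθ0 : θ ≠ 0 := fun h => by simp [h] at hθ
  refine algIndep_of_real_curves
    (Sum.elim (fun _ => 2) (Sum.elim (fun _ => 2) fun _ => 3))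
    (Sum.elim (fun _ => 2) (Sum.elim (fun m => 4 + 2 * (N - (m + 2))) fun b => cond b 2 3))
    (Sum.elim (fun _ => (-Complex.I * ħ) ^ 2) (Sum.elim (fun _ => (-Complex.I * ħ) ^ 2)
      fun b => cond b (-(-Complex.I * ħ) ^ 3) ((-Complex.I * ħ) ^ 3 * θ)))
    ?_ (Sum.elim (fun m => m + 1) fun _ => 0) fun Y hY => ?_
  · rintro (_ | _ | _ | _)
    · exact pow_ne_zero 2 hκ
    · exact pow_ne_zero 2 hκ
    · exact mul_ne_zero (pow_ne_zero 3 hκ) hθ0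
    · exact neg_ne_zero.2 (pow_ne_zero 3 hκ)
  have hYr : ∀ i, 0 < Y (.inr i) := fun i => (hY (.inr i)).1
  -- The index of the full Casimir element `C^(N)`.
  let M : Fin (N - 1) := ⟨N - 2, by omega⟩
  have hM : (M : ℕ) + 2 = N := Nat.sub_add_cancel hN
  have hYM : 0 < Y (.inl M) := lt_trans (Nat.cast_add_one_pos (N - 2)) (hY (.inl M)).1
  -- The leading coefficient of `R_+` is `y` times that of `C^(N)`, so `y` is settled first; `X`
  -- depends on it.
  obtain ⟨y, hy, hyY⟩ : ∃ y : ℝ, 0 < y ∧ y * Y (.inl M) = Y (.inr (.inr true)) :=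
    ⟨_, div_pos (hYr _) hYM, div_mul_cancel₀ _ hYM.ne'⟩
  obtain ⟨X, hX0, hX, hXY⟩ := exists_seq_of_partial_sums (fun m => hY (.inl m)) hy
  have hXM := hXY M
  rw [hM] at hXM
  have hρ : 0 < ∑ i ∈ Finset.range N, X i ^ 2 := by
    refine pos_of_mul_pos_right ?_ (pow_pos hy 2).le
    rw [hXM]
    exact hYM
  have hs : √(Y (.inl M)) ≠ 0 := (Real.sqrt_pos.2 hYM).ne'
  -- With `y` and `X` known, the leading coefficient of `R_-` is linear in `c` with nonzero slope.
  obtain ⟨c, hc⟩ : ∃ c : ℝ, y * √(Y (.inl M)) * (c * ∑ i ∈ Finset.range N, X i ^ 2)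
      = Y (.inr (.inr false)) :=
    ⟨Y (.inr (.inr false)) / (y * √(Y (.inl M)) * ∑ i ∈ Finset.range N, X i ^ 2), by
      field_simp⟩
  obtain ⟨Ξ, hΞ0, hΞ⟩ : ∃ Ξ : ℕ → ℝ, Ξ 0 = 0 ∧ ∀ m : Fin (N - 2),
      Ξ (N - (m + 2)) ^ 2 * ∑ i ∈ Finset.Ico (N - (m + 2) + 1) N, X i ^ 2
        = Y (.inr (.inl m)) := by
    -- The block of the last `m + 2` coordinates starts at `a = N - (m + 2)`, so `m = N - 2 - a`;
    -- the values of `Ξ` at other indices are irrelevant.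
    refine ⟨fun a => if h : 0 < a ∧ a < N - 1 then
      √(Y (.inr (.inl ⟨N - 2 - a, by omega⟩)) / ∑ i ∈ Finset.Ico (a + 1) N, X i ^ 2) else 0,
      by simp, fun m => ?_⟩
    have hm := m.2
    have hpos : 0 < ∑ i ∈ Finset.Ico (N - (m + 2) + 1) N, X i ^ 2 := by
      refine Finset.sum_pos (fun i hi => ?_) (Finset.nonempty_Ico.2 (by omega))
      obtain ⟨i, rfl⟩ := Nat.exists_eq_add_of_le' (show 1 ≤ i by
        have := (Finset.mem_Ico.1 hi).1; omega)
      exact pow_pos (hX i) 2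
    have hm' : (⟨N - 2 - (N - (m + 2)), by omega⟩ : Fin (N - 2)) = m :=
      Fin.ext (by simp only; omega)
    simp only
    rw [dif_pos ⟨by omega, by omega⟩, hm', Real.sq_sqrt (div_pos (hYr _) hpos).le,
      div_mul_cancel₀ _ hpos.ne']
  refine ⟨Sum.elim (fun m => curveUp X Ξ c y (m + 2))
    (Sum.elim (fun m => curveDown X Ξ (N - (m + 2)) N) fun b => cond b
      (fun u => y * curveUp X Ξ c y N u
        * (1 - k ^ 2 * (u ^ 2 * ∑ i ∈ Finset.range N, X i ^ 2)))
      (fun u => y * √(curveUp X Ξ c y N u)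
        * (1 + k ^ 2 * (u ^ 2 * ∑ i ∈ Finset.range N, X i ^ 2))
        * ∑ i ∈ Finset.range N, X i * curveSlope X Ξ c u i)), ?_, ?_, fun u hu => ?_⟩
  · rintro (m | m | _ | _)
    · exact continuous_curveUp _ _ _
    · exact continuous_curveDown _ _
    · dsimp only [Sum.elim_inr, cond]
      fun_prop
    · dsimp only [Sum.elim_inr, cond]
      fun_prop
  · rintro (m | m | _ | _)
    · exact (curveUp_zero _ _ _).trans (hXY m)
    · exact (curveDown_zero (by omega)).trans (hΞ m)
    · simp only [Sum.elim_inr, cond, curveUp_zero, sum_mul_curveSlope_zero c hX0, hXM, ← hc]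
      ring
    · simp only [Sum.elim_inr, cond, curveUp_zero, hXM, ← hyY]
      ring
  · have hx := curvePos_ne_zero hN hX hu
    have hl : u ^ 2 * curveUp X Ξ c y N u
        = gram .univ (curvePos N X u) fun i => curveMom X Ξ c y u i := by
      rw [← gram_range c y u hX0 hΞ0 (by omega), gram, gram, ← Fin.sum_univ_eq_sum_range,
        ← Fin.sum_univ_eq_sum_range, ← Fin.sum_univ_eq_sum_range
        (fun i => u * X i * curveMom X Ξ c y u i)]
      rfl
    have h0 : 0 ≤ curveUp X Ξ c y N u := by
      refine nonneg_of_mul_nonneg_right ?_ (pow_pos hu 2)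
      rw [hl]
      exact gram_nonneg _ _ _
    obtain ⟨v, hv, hLv⟩ := hL (curvePos N X u) (fun i => curveMom X Ξ c y u i)
      (u * √(curveUp X Ξ c y N u)) hx (by simp [curvePos, hj, hX0])
      (fun i => mul_nonneg hu.le (by
        cases i.val with
        | zero => exact hX0.ge
        | succ i => exact (hX i).le))
      (by simpa [curveMom, curveSlope, hj, hX0, hΞ0] using hy)
      (mul_nonneg hu.le (Real.sqrt_nonneg _)) (by rw [mul_pow, Real.sq_sqrt h0, hl])
    refine ⟨_, fun i => curveMom X Ξ c y u i, v, hx, hv, ?_⟩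
    rintro (m | m | _ | _)
    · exact hasEig_casimirUp ħ hX0 hΞ0 (by omega) (by omega)
    · exact hasEig_casimirDown ħ (by omega)
    · exact hasEig_Rminus ħ k μ hX0 hΞ0 hj hx hLv
    · exact hasEig_Rplus ħ k μ hX0 hΞ0 hj hx hθ h0 hLv

end Independence

/-! ### Superintegrability -/

section Superintegrability

variable {N : ℕ} {V : Type*} [NormedAddCommGroup V] [NormedSpace ℂ V]

theorem isIntegrable_hamiltonian [Nontrivial V] (hN : 2 ≤ N) {ħ : ℝ} (hħ : 0 < ħ) (k μ : ℝ) :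
    IsIntegrable N (hamiltonian ħ k μ : Op N V)
      (fun m : Fin (N - 1) => casimirUp ħ (m + 2)) where
  card_eq := by rw [Fintype.card_fin]; omega
  commute_H _ := hamiltonian_commute_casimir ħ k μ _
  commute i j := by
    have h : ∀ a b : ℕ, a ≤ b → Commute (casimirUp ħ a : Op N V) (casimirUp ħ b) :=
      fun a b hab => casimir_commute_casimir ħ
        (Finset.monotone_filter_right _ fun _ _ hi => hi.trans_le hab)
    rcases le_total i j with hij | hij
    · exact h _ _ (Nat.add_le_add_right hij 2)
    · exact (h _ _ (Nat.add_le_add_right hij 2)).symm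
  algIndep := algIndep_hamiltonian_casimirUp hN hħ k μ

theorem hasMaximalIntegrals_hamiltonian (hN : 2 ≤ N) {ħ : ℝ} (hħ : 0 < ħ) (k μ : ℝ) {L : Op N V}
    {j : Fin N} (hj : j.val = 0)
    (hr : RootRel (Complex.I * ħ) X (P ħ) rInv (Complex.I • L) j) {θ : ℂ} (hθ : θ ^ 2 = 1)
    (hL : ∀ (x : Space N) (ξ : Fin N → ℝ) (l : ℝ), x ≠ 0 → x j = 0 → (∀ i, 0 ≤ x i) → 0 < ξ j →
      0 ≤ l → l ^ 2 = gram .univ x ξ →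
      ∃ v : V, v ≠ 0 ∧ HasEig x ξ v 1 L (-Complex.I * ħ * (θ * l))) :
    HasMaximalIntegrals N (hamiltonian ħ k μ : Op N V) (integrals ħ k μ L j) where
  card_eq := by simp only [Fintype.card_sum, Fintype.card_fin, Fintype.card_bool]; omega
  commute_H := by
    rintro (m | m | _ | _)
    · exact hamiltonian_commute_casimir ħ k μ _
    · exact hamiltonian_commute_casimir ħ k μ _
    · exact hamiltonian_commute_Rminus ħ k μ hr
    · exact hamiltonian_commute_Rplus ħ k μ hr
  algIndep := algIndep_integrals hN hħ k μ hj hθ hL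

/-- Where `x_0 = 0` the symbol of `L` is proportional to `-x_1 ξ_0`, and the sign conditions
identify `x_1 ξ_0` with the nonnegative root `l`; hence `θ = -1`. -/
theorem exists_hasEig_angMom (ħ : ℝ) (x : Space 2) (ξ : Fin 2 → ℝ) {l : ℝ} (hx : x 0 = 0)
    (hx' : ∀ i, 0 ≤ x i) (hξ : 0 < ξ 0) (hl : 0 ≤ l) (hg : l ^ 2 = gram .univ x ξ) :
    ∃ v : ℂ, v ≠ 0 ∧ HasEig x ξ v 1 (angMom ħ 0 1) (-Complex.I * ħ * (-1 * l)) := by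
  have h : l = x 1 * ξ 0 := by
    rw [← Real.sqrt_sq hl, hg, ← Real.sqrt_sq (mul_nonneg (hx' 1) hξ.le)]
    congr 1
    simp only [gram, Fin.sum_univ_two, hx]
    ring
  refine ⟨1, one_ne_zero, (HasEig.angMom ħ 0 1).congr rfl ?_⟩
  rw [hx, h]
  push_cast
  ring

end Superintegrability

end Bertrand

theorem theorem4 (N : ℕ) (hN : 2 ≤ N) (ħ k μ : ℝ) (hħ : 0 < ħ) :
    (∀ (V : Type*) [NormedAddCommGroup V] [NormedSpace ℂ V] [Nontrivial V]
        (γ : Fin N → V →L[ℂ] V), Bertrand.IsClifford γ →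
      Bertrand.hamiltonian ħ k μ
          = Bertrand.hamiltonianOf ħ k μ (Bertrand.totalAngMom ħ γ) ∧
      Bertrand.IsIntegrable N (Bertrand.hamiltonian ħ k μ : Bertrand.Op N V)
        (fun m : Fin (N - 1) => Bertrand.casimirUp ħ (m + 2)) ∧
      Bertrand.HasMaximalIntegrals N (Bertrand.hamiltonian ħ k μ : Bertrand.Op N V)
        (Bertrand.integrals ħ k μ (Bertrand.totalAngMom ħ γ) ⟨0, by omega⟩)) ∧
    (N = 2 →
      Bertrand.hamiltonian ħ k μ
          = Bertrand.hamiltonianOf ħ k μ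
              (Bertrand.angMom ħ ⟨0, by omega⟩ ⟨1, by omega⟩ : Bertrand.Op N ℂ) ∧
      Bertrand.IsIntegrable N (Bertrand.hamiltonian ħ k μ : Bertrand.Op N ℂ)
        (fun m : Fin (N - 1) => Bertrand.casimirUp ħ (m + 2)) ∧
      Bertrand.HasMaximalIntegrals N (Bertrand.hamiltonian ħ k μ : Bertrand.Op N ℂ)
        (Bertrand.integrals ħ k μ (Bertrand.angMom ħ ⟨0, by omega⟩ ⟨1, by omega⟩)
          ⟨0, by omega⟩)) := by
  open Bertrand in
  refine ⟨fun V _ _ _ γ hγ => ?_, fun h => ?_⟩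
  · have hr := totalAngMom_rootRel ħ hγ ⟨0, by omega⟩
    refine ⟨hamiltonian_eq_hamiltonianOf ħ k μ hr, isIntegrable_hamiltonian hN hħ k μ,
      hasMaximalIntegrals_hamiltonian hN hħ k μ rfl hr (one_pow 2) fun x ξ l hx _ _ _ _ hl => ?_⟩
    rw [one_mul]
    exact exists_hasEig_totalAngMom ħ hγ hx ξ hl
  · subst h
    exact ⟨hamiltonian_eq_hamiltonianOf ħ k μ (angMom_rootRel ħ),
      isIntegrable_hamiltonian hN hħ k μ,
      hasMaximalIntegrals_hamiltonian hN hħ k μ rfl (angMom_rootRel ħ) (by norm_num)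
        fun x ξ l _ hx hx' hξ hl hg => exists_hasEig_angMom ħ x ξ hx hx' hξ hl hg⟩

end
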